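/- Let $n\ge 1$, let $\mathbb{C}_n$ be the real Clifford algebra with anticommuting generators $i_1,\dots,i_{n-1}$, $i_j^2=-1$, with reversal $x\mapsto x^*$, Clifford conjugation $x\mapsto\bar x$ and norm $|x|^2=\mathrm{Re}(x\bar x)$, and let $V_n=\{x_0+x_1i_1+\cdots+x_{n-1}i_{n-1}: x_j\in\mathbb{R}\}$ be its space of Clifford vectors. Let $\mathcal{H}^{n+1}=\{x_0+x_1i_1+\cdots+x_ni_n\in V_{n+1}: x_n>0\}$. The Clifford group $\mathbb{C}_n^\times$ is the group generated by the nonzero Clifford vectors, and $\mathrm{SL}_2(\mathbb{C}_n)$ is the group of matrices $\begin{pmatrix}a&b\\c&d\end{pmatrix}$ with $a,b,c,d\in\mathbb{C}_n^\times\cup\{0\}$, $ab^*,cd^*\in V_n$ and $ad^*-bc^*=1$; it acts on $\mathcal{H}^{n+1}$ and on $V_n\cup\{\infty\}$ by $x\mapsto(ax+b)(cx+d)^{-1}$. Let $d_1,\dots,d_{n-1}$ be positive rational numbers, let $K=\mathbb{Q}[\sqrt{d_1}\,i_1,\dots,\sqrt{d_{n-1}}\,i_{n-1}]\subset\mathbb{C}_n$,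 and let $\mathcal{O}\subset K$ be an order (a subring that is finitely generated as an abelian group and satisfies $\mathbb{Q}\mathcal{O}=K$) with $\mathcal{O}^*=\mathcal{O}$. Let $\mathrm{SL}_2(\mathcal{O})$ be the group of matrices in $\mathrm{SL}_2(\mathbb{C}_n)$ with entries in $\mathcal{O}$, let $\Gamma=\mathrm{PSL}_2(\mathcal{O})=\mathrm{SL}_2(\mathcal{O})/\{\pm1\}$, and let $\Gamma_\infty$ be the stabilizer of $\infty$ in $\Gamma$, i.e. the classes of matrices with $c=0$. A pair $(\lambda,\mu)\in\mathcal{O}^2$ is unimodular if it is the bottom row of a matrix in $\mathrm{SL}_2(\mathcal{O})$. Let $$B=\{x\in\mathcal{H}^{n+1}: |x-\mu^{-1}\lambda|>1/|\mu|\ \text{for all unimodular pairs }(\lambda,\mu)\text{ with }\mu\neq0\}$$ be the open bubble domain. A fundamental domain for a group $G$ acting on a space $E$ is a subset $D\subset E$ such that $E=\bigcup_{\gamma\in G}\gamma\overline{D}$ and such that $\gamma\in G$, $x\in D$, $\gamma x\in D$ imply $\gamma=e$. Let $F\subset V_n$ be a fundamental domain for $\Gamma_\infty$ acting on $V_n$.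 Then the $\Gamma$-orbits in $\mathcal{H}^{n+1}$ are discrete, and $$D=\{x_0+x_1i_1+\cdots+x_ni_n\in B: x_0+x_1i_1+\cdots+x_{n-1}i_{n-1}\in F\}$$ is a fundamental domain for $\Gamma$ acting on $\mathcal{H}^{n+1}$. If $F$ is open, then $D$ is open. -/

import Mathlib

noncomputable section

namespace CliffordBianchi

/-- The quadratic form `v ↦ -(v₁² + ⋯ + v_m²)` on `ℝᵐ`; in Mathlib's convention `ι v * ι v = Q v`,
so every standard generator squares to `-1`. -/
def negSumSq (m : ℕ) : QuadraticForm ℝ (Fin m → ℝ) :=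
  QuadraticMap.weightedSumSquares ℝ (fun _ : Fin m => (-1 : ℝ))

/-- `Cl m` is the real associative algebra with anticommuting generators `i₁, …, i_m` of square
`-1`: the Clifford numbers `ℂ_n` with `n = m + 1`. -/
abbrev Cl (m : ℕ) : Type := CliffordAlgebra (negSumSq m)

/-- The generator `i_{j+1}` of `Cl m`. -/
def gen {m : ℕ} (j : Fin m) : Cl m := CliffordAlgebra.ι (negSumSq m) (Pi.single j 1)

/-- The involution `x ↦ x*` reversing products of generators. -/
def rev {m : ℕ} (x : Cl m) : Cl m := CliffordAlgebra.reverse x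

/-- Clifford conjugation `x ↦ x̄ = (x')*`. -/
def conj {m : ℕ} (x : Cl m) : Cl m := CliffordAlgebra.reverse (CliffordAlgebra.involute x)

/-- The real part: the coefficient of `1` in the basis of ordered products of distinct generators.
(The linear isomorphism with the exterior algebra sends such products to wedge products.) -/
def re {m : ℕ} (x : Cl m) : ℝ :=
  ExteriorAlgebra.algebraMapInv (CliffordAlgebra.equivExterior (negSumSq m) x)

/-- The absolute value `|x| = √(Re (x x̄))`. -/
def absv {m : ℕ} (x : Cl m) : ℝ := Real.sqrt (re (x * conj x))

/-- The identification of `ℝ^{m+1}` with the space of Clifford vectors of `Cl m`: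
`(x₀, …, x_m) ↦ x₀ + x₁ i₁ + ⋯ + x_m i_m`, where `ι v = v₁ i₁ + ⋯ + v_m i_m`. -/
def vec {m : ℕ} (x : EuclideanSpace ℝ (Fin (m + 1))) : Cl m :=
  algebraMap ℝ (Cl m) (x 0) + CliffordAlgebra.ι (negSumSq m) (fun j => x j.succ)

/-- `Cl m` as a subalgebra of `Cl (m + 1)`, with `i_j ↦ i_j` for `1 ≤ j ≤ m`. -/
def incl (m : ℕ) : Cl m →ₐ[ℝ] Cl (m + 1) :=
  CliffordAlgebra.map
    { toFun := fun v => Fin.snoc v 0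
      map_add' := fun v w => by
        ext j; refine Fin.lastCases ?_ (fun i => ?_) j <;> simp
      map_smul' := fun r v => by
        ext j; refine Fin.lastCases ?_ (fun i => ?_) j <;> simp
      map_app' := fun v => by
        simp [negSumSq, QuadraticMap.weightedSumSquares_apply, Fin.sum_univ_castSucc] }

/-- The Clifford group: the group of units generated by the invertible Clifford vectors. -/
def cliffordGroup (m : ℕ) : Subgroup (Cl m)ˣ :=
  Subgroup.closure {u | ∃ x : EuclideanSpace ℝ (Fin (m + 1)), (u : Cl m) = vec x}

/-- The Clifford monoid: the Clifford group together with `0`. -/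
def cliffordMonoid (m : ℕ) : Set (Cl m) :=
  {x | x = 0 ∨ ∃ u ∈ cliffordGroup m, (u : Cl m) = x}

/-- `2 × 2` matrices over `Cl m`. -/
abbrev Mat (m : ℕ) : Type := Matrix (Fin 2) (Fin 2) (Cl m)

/-- Membership of `(a b; c d)` in the Clifford special linear group `SL₂`: the entries lie in the
Clifford monoid, `a b*` and `c d*` are Clifford vectors, and `a d* - b c* = 1`. -/
structure IsSL2 {m : ℕ} (g : Mat m) : Prop where
  entries : ∀ i j, g i j ∈ cliffordMonoid m
  row_zero : ∃ x, g 0 0 * rev (g 0 1) = vec x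
  row_one : ∃ x, g 1 0 * rev (g 1 1) = vec x
  pseudoDet : g 0 0 * rev (g 1 1) - g 0 1 * rev (g 1 0) = 1

/-- The rational Clifford algebra `ℚ[√d₁ i₁, …, √d_m i_m]` inside `Cl m`. -/
def ratClifford {m : ℕ} (d : Fin m → ℚ) : Subalgebra ℚ (Cl m) :=
  Algebra.adjoin ℚ (Set.range fun j => Real.sqrt (d j) • gen j)

/-- `O` is an order in the rational Clifford algebra with parameters `d`, stable under reversal: a
subring, finitely generated as an abelian group, whose `ℚ`-span is the whole rational algebra. -/
structure IsStarOrder {m : ℕ} (d : Fin m → ℚ) (O : Subring (Cl m)) : Prop where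
  fg : O.toAddSubgroup.FG
  span : Submodule.span ℚ (O : Set (Cl m)) = Subalgebra.toSubmodule (ratClifford d)
  rev_mem : ∀ x ∈ O, rev x ∈ O

/-- The matrices of `SL₂(O)`. An element of `PSL₂(O)` is such a matrix up to sign. -/
def SL2 {m : ℕ} (O : Subring (Cl m)) : Set (Mat m) :=
  {g | IsSL2 g ∧ ∀ i j, g i j ∈ O}

/-- The matrices of the stabilizer of `∞`, where `g(∞) = a c⁻¹`. -/
def SL2Infty {m : ℕ} (O : Subring (Cl m)) : Set (Mat m) :=
  {g | g ∈ SL2 O ∧ g 1 0 = 0}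

/-- The Möbius formula `(a x + b) (c x + d)⁻¹`. -/
def moebius {m : ℕ} (g : Mat m) (x : Cl m) : Cl m :=
  (g 0 0 * x + g 0 1) * Ring.inverse (g 1 0 * x + g 1 1)

/-- The space `V_n` of Clifford vectors of `Cl m`, `n = m + 1`, in coordinates. -/
abbrev V (m : ℕ) : Type := EuclideanSpace ℝ (Fin (m + 1))

/-- Hyperbolic space `H^{n+1}`, `n = m + 1`: the points `x₀ + x₁ i₁ + ⋯ + x_n i_n` of `V_{n+1}` with
`x_n > 0`. -/
abbrev Hyp (m : ℕ) : Type := {x : V (m + 1) // 0 < x (Fin.last (m + 1))}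

/-- The projection `x₀ + ⋯ + x_n i_n ↦ x₀ + ⋯ + x_{n-1} i_{n-1}`. -/
def proj {m : ℕ} (x : Hyp m) : V m := WithLp.toLp 2 fun j => x.1 j.castSucc

/-- `g · x = y` for points `x`, `y` of `V_n`. -/
def MapsV {m : ℕ} (g : Mat m) (x y : V m) : Prop :=
  vec y = moebius g (vec x)

/-- `g · x = y` for points `x`, `y` of `H^{n+1}`; the formula is evaluated in `Cl (m + 1)`. -/
def MapsH {m : ℕ} (g : Mat m) (x y : Hyp m) : Prop :=
  vec y.1 = moebius (g.map (incl m)) (vec x.1)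

/-- Fundamental domains for the action of a group `Γ` of matrices modulo `±1` on a space `E`, where
`act g x y` says `g · x = y`: the translates of the closure of `D` cover `E`, and only the
identity of `Γ / ±1` maps a point of `D` into `D`. -/
structure IsFundamentalDomain {m : ℕ} {E : Type} [TopologicalSpace E] (Γ : Set (Mat m))
    (act : Mat m → E → E → Prop) (D : Set E) : Prop where
  cover : ∀ x, ∃ g ∈ Γ, ∃ y ∈ closure D, act g y x
  free : ∀ g ∈ Γ, ∀ x ∈ D, ∀ y ∈ D, act g x y → g = 1 ∨ g = -1

/-- `(l, u)` is unimodular: it is the bottom row of a matrix in `SL₂(O)`. -/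
def Unimodular {m : ℕ} (O : Subring (Cl m)) (l u : Cl m) : Prop :=
  ∃ g ∈ SL2 O, g 1 0 = l ∧ g 1 1 = u

/-- The open bubble domain: the points strictly outside all spheres with centre `u⁻¹ l` and radius
`1 / |u|`, for `(l, u)` unimodular with `u ≠ 0`. -/
def bubbleDomain {m : ℕ} (O : Subring (Cl m)) : Set (Hyp m) :=
  {x | ∀ l u, Unimodular O l u → u ≠ 0 →
    1 / absv u < absv (vec x.1 - incl m (Ring.inverse u * l))}

end CliffordBianchi

end

/-!
The group `SL₂(O)` acts on hyperbolic space with heights changing by the rule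
`height (g x) = height x / |c x + d|²`, where `(c, d)` is the bottom row of `g`. Everything follows
from this rule and from one finiteness statement: for fixed `x`, only finitely many rows with
entries in `O` satisfy `|c x + d| ≤ R` (`finite_rows`). The latter holds because the height of `x`
bounds `|c|`, then `|d|` is bounded, and an order has finitely many elements of bounded absolute
value (`finite_nsq_le`): `Re (x x̄)` is the sum of the squares of the coefficients of `x` in the
basis of products of generators (`nsq_eq_sum`), and elements of an order have coefficients in fixed
rank one lattices (`exists_denominator`).

* The pairs `(l, u)` defining the bubble domain are bottom rows up to the substitution
  `(l, u) ↦ (u, -l)`, so the bubble domain is the set where `|c x + d| > 1` for all bottom rows with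
  `c ≠ 0` (`mem_bubbleDomain_iff`). By finiteness it is locally a finite intersection of open
  conditions, hence open.
* Free: if `g` maps a point of the domain into the domain and `c ≠ 0`, both `g` and `g⁻¹` lower the
  height strictly, which is absurd. So `g` fixes `∞`, and the hypothesis on `F` applies.
* Cover: by finiteness an orbit has a point `y` of maximal height, and then `|c y + d| ≥ 1` for all
  bottom rows. An element of the stabilizer of `∞` moves the projection of `y` into the closure of
  `F`. It preserves the height by maximality, so the new point satisfies the same
  inequalities. Raising its height makes them strict and moves it into the open bubble domain, so it
  lies in the closure of the domain (`mem_closure_of_one_le`).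
* Discrete orbits: matrices moving `x` into a bounded region of height bounded below have both rows
  bounded in the above sense, so there are finitely many of them.

The algebraic input is that Clifford matrices form a group acting on vectors. Its
key point is that `V` is stable under `x ↦ u x u*` for `u` in the Clifford monoid: the row
conditions then imply column conditions (`IsSL2.col_mem`), and an entry `a p + b r` of a product
equals `a (a⁻¹ b + p r⁻¹) r` with a Clifford vector in the middle (`IsSL2.mul_entries`).
-/

noncomputable section

namespace CliffordBianchi

open CliffordAlgebra Topology

variable {m : ℕ}

/-! ### Clifford vectors -/

theorem rev_mul (x y : Cl m) : rev (x * y) = rev y * rev x := reverse.map_mul x y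

theorem rev_rev (x : Cl m) : rev (rev x) = x := reverse_reverse x

theorem rev_one : rev (1 : Cl m) = 1 := reverse.map_one

theorem rev_zero : rev (0 : Cl m) = 0 := map_zero _

theorem rev_add (x y : Cl m) : rev (x + y) = rev x + rev y := map_add _ x y

theorem rev_sub (x y : Cl m) : rev (x - y) = rev x - rev y := map_sub _ x y

theorem rev_neg (x : Cl m) : rev (-x) = -rev x := map_neg _ x

theorem conj_eq (x : Cl m) : conj x = rev (involute x) := rfl

theorem conj_mul (x y : Cl m) : conj (x * y) = conj y * conj x := by
  simp [conj_eq, rev_mul]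

theorem conj_add (x y : Cl m) : conj (x + y) = conj x + conj y := by
  simp [conj_eq, rev_add]

theorem conj_sub (x y : Cl m) : conj (x - y) = conj x - conj y := by
  simp [conj_eq, rev_sub]

theorem conj_smul (r : ℝ) (x : Cl m) : conj (r • x) = r • conj x := by
  simp [conj_eq, rev]

theorem conj_algebraMap (r : ℝ) : conj (algebraMap ℝ (Cl m) r) = algebraMap ℝ (Cl m) r := by
  simp [conj_eq, rev, reverse.commutes]

theorem conj_one : conj (1 : Cl m) = 1 := by
  simpa using conj_algebraMap (m := m) 1

theorem conj_rev (x : Cl m) : conj (rev x) = rev (conj x) := by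
  simp [conj_eq, rev, reverse_involute]

theorem negSumSq_apply (v : Fin m → ℝ) : negSumSq m v = -∑ j, v j ^ 2 := by
  simp [negSumSq, QuadraticMap.weightedSumSquares_apply, sq]

theorem vec_apply (x : V m) :
    vec x = algebraMap ℝ (Cl m) (x 0) + ι (negSumSq m) (fun j => x j.succ) := rfl

theorem vec_add (x y : V m) : vec (x + y) = vec x + vec y := by
  have : (fun j : Fin m => (x + y) j.succ) = (fun j => x j.succ) + fun j => y j.succ := rfl
  rw [vec_apply, this, map_add]
  simp only [PiLp.add_apply, map_add, vec_apply]
  abel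

theorem vec_smul (r : ℝ) (x : V m) : vec (r • x) = r • vec x := by
  have : (fun j : Fin m => (r • x) j.succ) = r • fun j => x j.succ := rfl
  rw [vec_apply, this, map_smul, vec_apply, smul_add]
  simp [Algebra.smul_def]

theorem vec_zero : vec (0 : V m) = 0 := by simpa using vec_smul (0 : ℝ) (0 : V m)

theorem vec_neg (x : V m) : vec (-x) = -vec x := by simpa using vec_smul (-1 : ℝ) x

theorem vec_sub (x y : V m) : vec (x - y) = vec x - vec y := by
  rw [sub_eq_add_neg, vec_add, vec_neg, sub_eq_add_neg]

/-- The space of Clifford vectors, as a linear subspace of `Cl m`. -/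
def Vec (m : ℕ) : Submodule ℝ (Cl m) where
  carrier := {y | ∃ x, y = vec x}
  add_mem' := by rintro _ _ ⟨x, rfl⟩ ⟨y, rfl⟩; exact ⟨x + y, (vec_add x y).symm⟩
  zero_mem' := ⟨0, vec_zero.symm⟩
  smul_mem' := by rintro r _ ⟨x, rfl⟩; exact ⟨r • x, (vec_smul r x).symm⟩

theorem mem_Vec {y : Cl m} : y ∈ Vec m ↔ ∃ x, y = vec x := Iff.rfl

theorem vec_mem (x : V m) : vec x ∈ Vec m := ⟨x, rfl⟩

theorem algebraMap_mem_Vec (r : ℝ) : algebraMap ℝ (Cl m) r ∈ Vec m := by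
  refine ⟨WithLp.toLp 2 (Fin.cons r 0), ?_⟩
  have : (fun _ : Fin m => (0 : ℝ)) = 0 := rfl
  simp [vec_apply, this]

theorem ι_mem_Vec (v : Fin m → ℝ) : ι (negSumSq m) v ∈ Vec m := by
  refine ⟨WithLp.toLp 2 (Fin.cons 0 v), ?_⟩
  simp [vec_apply]

theorem rev_vec (x : V m) : rev (vec x) = vec x := by
  simp [vec_apply, rev, reverse.commutes]

theorem rev_of_mem_Vec {y : Cl m} (h : y ∈ Vec m) : rev y = y := by
  obtain ⟨x, rfl⟩ := h; exact rev_vec x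

theorem conj_vec (x : V m) :
    conj (vec x) = algebraMap ℝ (Cl m) (x 0) - ι (negSumSq m) (fun j => x j.succ) := by
  simp [vec_apply, conj, reverse.commutes, sub_eq_add_neg]

theorem conj_mem_Vec {y : Cl m} (h : y ∈ Vec m) : conj y ∈ Vec m := by
  obtain ⟨x, rfl⟩ := h
  rw [conj_vec]
  exact sub_mem (algebraMap_mem_Vec _) (ι_mem_Vec _)

theorem vec_mul_conj (x : V m) : vec x * conj (vec x) = algebraMap ℝ (Cl m) (‖x‖ ^ 2) := by
  rw [conj_vec, vec_apply]
  set b := ι (negSumSq m) (fun j => x j.succ) with hb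
  have h1 : algebraMap ℝ (Cl m) (x 0) * b = b * algebraMap ℝ (Cl m) (x 0) := Algebra.commutes _ _
  have h2 : b * b = -algebraMap ℝ (Cl m) (∑ j : Fin m, x j.succ ^ 2) := by
    rw [hb, ι_sq_scalar, negSumSq_apply, map_neg]
  rw [add_mul, mul_sub, mul_sub, h2, h1, EuclideanSpace.norm_sq_eq, Fin.sum_univ_succ]
  simp only [Real.norm_eq_abs, sq_abs, map_add, map_pow]
  noncomm_ring

theorem conj_mul_vec (x : V m) : conj (vec x) * vec x = algebraMap ℝ (Cl m) (‖x‖ ^ 2) := by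
  rw [← vec_mul_conj, conj_vec, vec_apply]
  set b := ι (negSumSq m) (fun j => x j.succ) with hb
  have h1 : algebraMap ℝ (Cl m) (x 0) * b = b * algebraMap ℝ (Cl m) (x 0) := Algebra.commutes _ _
  rw [add_mul, mul_sub, mul_sub, sub_mul, mul_add, mul_add, h1]
  abel

/-- The product `v w v` of Clifford vectors is a Clifford vector. -/
theorem mul_mul_self_mem_Vec {v w : Cl m} (hv : v ∈ Vec m) (hw : w ∈ Vec m) :
    v * w * v ∈ Vec m := by
  obtain ⟨x, rfl⟩ := hv
  obtain ⟨y, rfl⟩ := hw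
  rw [vec_apply, vec_apply]
  set a := ι (negSumSq m) (fun j => x j.succ) with ha
  set b := ι (negSumSq m) (fun j => y j.succ) with hb
  have h1 : a * b * a ∈ Vec m := by rw [ha, hb, ι_mul_ι_mul_ι]; exact ι_mem_Vec _
  have h2 : a * b + b * a ∈ Vec m := by
    rw [ha, hb, ι_mul_ι_add_swap]; exact algebraMap_mem_Vec _
  have h3 : a * a ∈ Vec m := by rw [ha, ι_sq_scalar]; exact algebraMap_mem_Vec _
  have h4 : a ∈ Vec m := ι_mem_Vec _
  have h5 : b ∈ Vec m := ι_mem_Vec _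
  have h6 : (1 : Cl m) ∈ Vec m := by simpa using algebraMap_mem_Vec (m := m) 1
  have : (algebraMap ℝ (Cl m) (x 0) + a) * (algebraMap ℝ (Cl m) (y 0) + b) *
      (algebraMap ℝ (Cl m) (x 0) + a) =
      (x 0 ^ 2 * y 0) • (1 : Cl m) + (2 * x 0 * y 0) • a + y 0 • (a * a) + x 0 ^ 2 • b
        + x 0 • (a * b + b * a) + a * b * a := by
    simp only [Algebra.algebraMap_eq_smul_one, add_mul, mul_add, smul_mul_assoc, one_mul,
      mul_smul_comm, mul_one, smul_smul, smul_add]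
    module
  rw [this]
  exact add_mem (add_mem (add_mem (add_mem (add_mem (Submodule.smul_mem _ _ h6)
    (Submodule.smul_mem _ _ h4)) (Submodule.smul_mem _ _ h3)) (Submodule.smul_mem _ _ h5))
    (Submodule.smul_mem _ _ h2)) h1

/-- Polarization of `mul_mul_self_mem_Vec`. -/
theorem mul_mul_add_mem_Vec {q p r : Cl m} (hq : q ∈ Vec m) (hp : p ∈ Vec m) (hr : r ∈ Vec m) :
    q * r * p + p * r * q ∈ Vec m := by
  have h := sub_mem (sub_mem (mul_mul_self_mem_Vec (add_mem hq hp) hr)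
    (mul_mul_self_mem_Vec hq hr)) (mul_mul_self_mem_Vec hp hr)
  convert h using 1
  noncomm_ring

/-! ### The real part and the absolute value -/

theorem re_add (x y : Cl m) : re (x + y) = re x + re y := by simp [re]

theorem re_sub (x y : Cl m) : re (x - y) = re x - re y := by simp [re]

theorem re_neg (x : Cl m) : re (-x) = -re x := by simp [re]

theorem re_smul (r : ℝ) (x : Cl m) : re (r • x) = r * re x := by simp [re]

theorem re_algebraMap (r : ℝ) : re (algebraMap ℝ (Cl m) r) = r := by
  simp [re]

/-- The square `Re (x x̄)` of the absolute value. -/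
def nsq (x : Cl m) : ℝ := re (x * conj x)

theorem absv_eq (x : Cl m) : absv x = Real.sqrt (nsq x) := rfl

theorem nsq_vec (x : V m) : nsq (vec x) = ‖x‖ ^ 2 := by
  rw [nsq, vec_mul_conj, re_algebraMap]

theorem nsq_zero : nsq (0 : Cl m) = 0 := by simp [nsq, re]

theorem nsq_one : nsq (1 : Cl m) = 1 := by
  simpa [nsq, conj_one] using re_algebraMap (m := m) 1

theorem nsq_add_add_nsq_sub (x y : Cl m) :
    nsq (x + y) + nsq (x - y) = 2 * nsq x + 2 * nsq y := by
  simp only [nsq, conj_add, conj_sub, add_mul, mul_add, sub_mul, mul_sub, re_add, re_sub]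
  ring

theorem vec_injective : Function.Injective (vec : V m → Cl m) := by
  intro x y h
  have : nsq (vec (x - y)) = 0 := by rw [vec_sub, h, sub_self, nsq_zero]
  rw [nsq_vec] at this
  exact sub_eq_zero.mp (by simpa using this)

/-! ### The Clifford monoid -/

/-- A nonzero Clifford vector is invertible, with inverse `x̄ / |x|²`. -/
theorem exists_unit_vec {x : V m} (hx : x ≠ 0) :
    ∃ u : (Cl m)ˣ, (u : Cl m) = vec x ∧ ((u⁻¹ : (Cl m)ˣ) : Cl m) = (‖x‖ ^ 2)⁻¹ • conj (vec x) := by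
  have h : ‖x‖ ^ 2 ≠ 0 := by positivity
  refine ⟨⟨vec x, (‖x‖ ^ 2)⁻¹ • conj (vec x), ?_, ?_⟩, rfl, rfl⟩
  · rw [mul_smul_comm, vec_mul_conj, Algebra.smul_def, ← map_mul, inv_mul_cancel₀ h, map_one]
  · rw [smul_mul_assoc, conj_mul_vec, Algebra.smul_def, ← map_mul, inv_mul_cancel₀ h, map_one]

theorem unit_vec_inv {u : (Cl m)ˣ} {x : V m} (h : (u : Cl m) = vec x) :
    ((u⁻¹ : (Cl m)ˣ) : Cl m) ∈ Vec m := by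
  have hx : x ≠ 0 := by
    rintro rfl
    rw [vec_zero] at h
    exact u.ne_zero h
  obtain ⟨w, hw, hw'⟩ := exists_unit_vec hx
  have : u = w := Units.ext (h.trans hw.symm)
  rw [this, hw']
  exact Submodule.smul_mem _ _ (conj_mem_Vec (vec_mem x))

/-- Induction for the Clifford group: the generating set is closed under inverses, so only
products of invertible vectors need to be treated. -/
@[elab_as_elim]
theorem cliffordGroup_induction {p : (Cl m)ˣ → Prop} (one : p 1)
    (vec_mul : ∀ u v : (Cl m)ˣ, (u : Cl m) ∈ Vec m → p v → p (u * v))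
    {u : (Cl m)ˣ} (hu : u ∈ cliffordGroup m) : p u := by
  induction hu using Subgroup.closure_induction_left with
  | one => exact one
  | mul_left x hx y hy ih => exact vec_mul x y hx ih
  | inv_mul_cancel x hx y hy ih =>
    obtain ⟨v, hv⟩ := hx
    exact vec_mul x⁻¹ y (unit_vec_inv hv) ih

theorem mem_cliffordGroup_of_mem_Vec {u : (Cl m)ˣ} (h : (u : Cl m) ∈ Vec m) :
    u ∈ cliffordGroup m := Subgroup.subset_closure h

theorem mem_monoid_of_group {u : (Cl m)ˣ} (h : u ∈ cliffordGroup m) :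
    (u : Cl m) ∈ cliffordMonoid m := Or.inr ⟨u, h, rfl⟩

theorem zero_mem_monoid : (0 : Cl m) ∈ cliffordMonoid m := Or.inl rfl

theorem one_mem_monoid : (1 : Cl m) ∈ cliffordMonoid m :=
  Or.inr ⟨1, one_mem _, rfl⟩

theorem mul_mem_monoid {x y : Cl m} (hx : x ∈ cliffordMonoid m) (hy : y ∈ cliffordMonoid m) :
    x * y ∈ cliffordMonoid m := by
  rcases hx with rfl | ⟨u, hu, rfl⟩
  · simpa using zero_mem_monoid
  rcases hy with rfl | ⟨v, hv, rfl⟩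
  · simpa using zero_mem_monoid
  exact Or.inr ⟨u * v, mul_mem hu hv, by simp⟩

theorem vec_mem_monoid {x : Cl m} (hx : x ∈ Vec m) : x ∈ cliffordMonoid m := by
  by_cases h : x = 0
  · exact Or.inl h
  obtain ⟨y, rfl⟩ := hx
  have hy : y ≠ 0 := by rintro rfl; exact h vec_zero
  obtain ⟨u, hu, -⟩ := exists_unit_vec hy
  exact Or.inr ⟨u, mem_cliffordGroup_of_mem_Vec ⟨y, hu⟩, hu⟩

theorem neg_mem_monoid {x : Cl m} (hx : x ∈ cliffordMonoid m) : -x ∈ cliffordMonoid m := by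
  have : (-1 : Cl m) ∈ Vec m := by simpa using algebraMap_mem_Vec (m := m) (-1)
  simpa using mul_mem_monoid (vec_mem_monoid this) hx

theorem rev_mem_monoid {x : Cl m} (hx : x ∈ cliffordMonoid m) : rev x ∈ cliffordMonoid m := by
  rcases hx with rfl | ⟨u, hu, rfl⟩
  · simpa [rev_zero] using zero_mem_monoid
  refine cliffordGroup_induction ?_ (fun u v hu ih => ?_) hu
  · simpa [rev_one] using one_mem_monoid
  · rw [Units.val_mul, rev_mul, rev_of_mem_Vec hu]
    exact mul_mem_monoid ih (vec_mem_monoid hu)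

/-- The twisted action `x ↦ u x u*` of the Clifford monoid preserves the Clifford vectors. -/
theorem mul_mul_rev_mem_Vec {u x : Cl m} (hu : u ∈ cliffordMonoid m) (hx : x ∈ Vec m) :
    u * x * rev u ∈ Vec m := by
  rcases hu with rfl | ⟨u, hu, rfl⟩
  · simp
  refine cliffordGroup_induction ?_ (fun u v hu ih => ?_) hu
  · simpa [rev_one] using hx
  · rw [Units.val_mul, rev_mul, rev_of_mem_Vec hu]
    convert mul_mul_self_mem_Vec hu ih using 1
    noncomm_ring

theorem rev_mul_mul_mem_Vec {u x : Cl m} (hu : u ∈ cliffordMonoid m) (hx : x ∈ Vec m) :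
    rev u * x * u ∈ Vec m := by
  simpa [rev_rev] using mul_mul_rev_mem_Vec (rev_mem_monoid hu) hx

/-- For `u` in the Clifford monoid, `u ū` is a real scalar, positive unless `u = 0`. -/
theorem exists_mul_conj {u : Cl m} (hu : u ∈ cliffordMonoid m) :
    ∃ r : ℝ, (u ≠ 0 → 0 < r) ∧ u * conj u = algebraMap ℝ (Cl m) r ∧
      conj u * u = algebraMap ℝ (Cl m) r := by
  rcases hu with rfl | ⟨u, hu, rfl⟩
  · exact ⟨0, by simp, by simp, by simp⟩
  suffices H : ∃ r : ℝ, 0 < r ∧ (u : Cl m) * conj u = algebraMap ℝ (Cl m) r ∧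
      conj (u : Cl m) * u = algebraMap ℝ (Cl m) r by
    obtain ⟨r, hr, h⟩ := H
    exact ⟨r, fun _ => hr, h⟩
  refine cliffordGroup_induction ?_ (fun u v hu ih => ?_) hu
  · exact ⟨1, one_pos, by simp [conj_one], by simp [conj_one]⟩
  · obtain ⟨r, hr, h1, h2⟩ := ih
    obtain ⟨x, hx⟩ := hu
    have hx0 : x ≠ 0 := by
      rintro rfl
      rw [vec_zero] at hx
      exact u.ne_zero hx
    refine ⟨‖x‖ ^ 2 * r, by positivity, ?_, ?_⟩
    · rw [Units.val_mul, conj_mul, mul_assoc, ← mul_assoc (v : Cl m), h1, Algebra.commutes,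
        ← mul_assoc, hx, vec_mul_conj, map_mul]
    · rw [Units.val_mul, conj_mul, mul_assoc, ← mul_assoc _ (u : Cl m), hx, conj_mul_vec,
        Algebra.commutes, ← mul_assoc, h2, ← map_mul, mul_comm]

theorem mul_conj {u : Cl m} (hu : u ∈ cliffordMonoid m) :
    u * conj u = algebraMap ℝ (Cl m) (nsq u) := by
  obtain ⟨r, -, h, -⟩ := exists_mul_conj hu
  rw [nsq, h, re_algebraMap]

theorem conj_mul_self {u : Cl m} (hu : u ∈ cliffordMonoid m) :
    conj u * u = algebraMap ℝ (Cl m) (nsq u) := by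
  obtain ⟨r, -, h, h'⟩ := exists_mul_conj hu
  rw [nsq, h, h', re_algebraMap]

theorem nsq_pos {u : Cl m} (hu : u ∈ cliffordMonoid m) (h0 : u ≠ 0) : 0 < nsq u := by
  obtain ⟨r, hr, h, -⟩ := exists_mul_conj hu
  rw [nsq, h, re_algebraMap]
  exact hr h0

theorem nsq_mul (x : Cl m) {y : Cl m} (hy : y ∈ cliffordMonoid m) :
    nsq (x * y) = nsq x * nsq y := by
  rw [nsq, conj_mul, mul_assoc, ← mul_assoc y, mul_conj hy, Algebra.commutes, ← mul_assoc,
    ← Algebra.commutes, ← Algebra.smul_def, re_smul, mul_comm]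
  rfl

theorem nsq_rev {u : Cl m} (hu : u ∈ cliffordMonoid m) : nsq (rev u) = nsq u := by
  rw [nsq, conj_rev, ← rev_mul, conj_mul_self hu, rev, reverse.commutes, re_algebraMap]

/-! ### The basis of products of generators, and finiteness in orders -/

theorem gen_mul_self (j : Fin m) : gen j * gen j = -1 := by
  rw [gen, ι_sq_scalar, negSumSq_apply]
  simp [Pi.single_apply]

theorem gen_mul_gen {i j : Fin m} (h : i ≠ j) : gen i * gen j = -(gen j * gen i) := by
  refine ι_mul_ι_comm_of_isOrtho ?_
  rw [QuadraticMap.isOrtho_def, negSumSq_apply, negSumSq_apply, negSumSq_apply, ← neg_add,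
    ← Finset.sum_add_distrib]
  congr 1
  refine Finset.sum_congr rfl fun k _ => ?_
  by_cases hi : k = i
  · subst hi; simp [h]
  · simp [hi]

theorem gen_mem_Vec (j : Fin m) : (gen j : Cl m) ∈ Vec m := ι_mem_Vec _

theorem conj_gen (j : Fin m) : conj (gen j) = -gen j := by
  simp [conj, gen]

/-- The product of generators spelled by a list of indices. -/
def word (l : List (Fin m)) : Cl m := (l.map gen).prod

theorem word_nil : word ([] : List (Fin m)) = 1 := rfl

theorem word_cons (a : Fin m) (l : List (Fin m)) : word (a :: l) = gen a * word l := by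
  simp [word]

theorem word_append (l l' : List (Fin m)) : word (l ++ l') = word l * word l' := by
  simp [word]

/-- Equality up to sign. -/
def EqSign (x y : Cl m) : Prop := ∃ e : ℤˣ, x = ((e : ℤ) : ℝ) • y

theorem EqSign.refl (x : Cl m) : EqSign x x := ⟨1, by simp⟩

theorem EqSign.neg (x : Cl m) : EqSign (-x) x := ⟨-1, by simp⟩

theorem EqSign.trans {x y z : Cl m} : EqSign x y → EqSign y z → EqSign x z := by
  rintro ⟨e, rfl⟩ ⟨f, rfl⟩
  exact ⟨e * f, by simp [smul_smul]⟩

theorem EqSign.mul_left {x y : Cl m} (z : Cl m) : EqSign x y → EqSign (z * x) (z * y) := by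
  rintro ⟨e, rfl⟩
  exact ⟨e, by simp⟩

theorem EqSign.mul_right {x y : Cl m} (z : Cl m) : EqSign x y → EqSign (x * z) (y * z) := by
  rintro ⟨e, rfl⟩
  exact ⟨e, by simp⟩

theorem word_perm {l l' : List (Fin m)} (h : l.Perm l') : EqSign (word l) (word l') := by
  induction h with
  | nil => exact .refl _
  | cons a _ ih => rw [word_cons, word_cons]; exact ih.mul_left _
  | swap a b l =>
    simp only [word_cons, ← mul_assoc]
    refine EqSign.mul_right _ ?_
    by_cases h : a = b
    · subst h; exact .refl _
    · rw [gen_mul_gen (Ne.symm h)]; exact .neg _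
  | trans _ _ h1 h2 => exact h1.trans h2

/-- The product of the generators with index in `S`, in some fixed order. -/
def basisWord (S : Finset (Fin m)) : Cl m := word S.toList

theorem basisWord_empty : basisWord (∅ : Finset (Fin m)) = 1 := by
  simp [basisWord, word_nil]

theorem gen_mul_basisWord (a : Fin m) (S : Finset (Fin m)) :
    EqSign (gen a * basisWord S) (basisWord (symmDiff {a} S)) := by
  by_cases h : a ∈ S
  · have h1 : EqSign (basisWord S) (gen a * basisWord (S.erase a)) := by
      rw [basisWord, basisWord, ← word_cons]
      apply word_perm
      have := Finset.toList_insert (Finset.notMem_erase a S)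
      rwa [Finset.insert_erase h] at this
    have h2 : symmDiff {a} S = S.erase a := by
      ext x
      by_cases hx : x = a
      · subst hx; simp [Finset.mem_symmDiff, h]
      · simp [Finset.mem_symmDiff, hx]
    rw [h2]
    refine (h1.mul_left (gen a)).trans ?_
    rw [← mul_assoc, gen_mul_self, neg_one_mul]
    exact .neg _
  · have h2 : symmDiff {a} S = insert a S := by
      ext x
      by_cases hx : x = a
      · subst hx; simp [Finset.mem_symmDiff, h]
      · simp [Finset.mem_symmDiff, hx]
    rw [h2, basisWord, basisWord, ← word_cons]
    exact word_perm (Finset.toList_insert h).symm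

theorem word_mul_basisWord {l : List (Fin m)} (hl : l.Nodup) (S : Finset (Fin m)) :
    EqSign (word l * basisWord S) (basisWord (symmDiff l.toFinset S)) := by
  induction l with
  | nil =>
    rw [word_nil, one_mul, List.toFinset_nil, ← Finset.bot_eq_empty, bot_symmDiff]
    exact .refl _
  | cons a l ih =>
    rw [List.nodup_cons] at hl
    have h : symmDiff (a :: l).toFinset S = symmDiff {a} (symmDiff l.toFinset S) := by
      rw [← symmDiff_assoc]
      congr 1
      ext x
      by_cases hx : x = a
      · subst hx; simp [Finset.mem_symmDiff, hl.1]
      · simp [Finset.mem_symmDiff, hx]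
    rw [h, word_cons, mul_assoc]
    exact ((ih hl.2).mul_left _).trans (gen_mul_basisWord _ _)

theorem basisWord_mul (S T : Finset (Fin m)) :
    EqSign (basisWord S * basisWord T) (basisWord (symmDiff S T)) := by
  simpa [basisWord] using word_mul_basisWord S.nodup_toList T

theorem word_mem_monoid (l : List (Fin m)) : word l ∈ cliffordMonoid m := by
  induction l with
  | nil => exact one_mem_monoid
  | cons a l ih => rw [word_cons]; exact mul_mem_monoid (vec_mem_monoid (gen_mem_Vec a)) ih

theorem nsq_gen (j : Fin m) : nsq (gen j) = 1 := by
  rw [nsq, conj_gen, mul_neg, gen_mul_self, neg_neg]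
  simpa using re_algebraMap (m := m) 1

theorem nsq_word (l : List (Fin m)) : nsq (word l) = 1 := by
  induction l with
  | nil => exact nsq_one
  | cons a l ih => rw [word_cons, nsq_mul _ (word_mem_monoid l), nsq_gen, ih, one_mul]

theorem conj_word (l : List (Fin m)) : EqSign (conj (word l)) (word l) := by
  have h : EqSign (conj (word l)) (word l.reverse) := by
    induction l with
    | nil => simpa [word_nil, conj_one] using EqSign.refl _
    | cons a l ih =>
      rw [word_cons, conj_mul, List.reverse_cons, word_append, word_cons, word_nil, mul_one,
        conj_gen, mul_neg]
      exact (EqSign.neg _).trans (ih.mul_right _)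
  exact h.trans (word_perm l.reverse_perm)

/-- The isomorphism with the exterior algebra turns a product of distinct generators into the
corresponding wedge product, because all contraction terms vanish. -/
theorem equivExterior_word {l : List (Fin m)} (hl : l.Nodup) :
    equivExterior (negSumSq m) (word l) =
      (l.map fun j => ExteriorAlgebra.ι ℝ (Pi.single j (1 : ℝ) : Fin m → ℝ)).prod ∧
    ∀ a, a ∉ l → contractLeft (QuadraticMap.associated (R := ℝ) (-negSumSq m) (Pi.single a 1))
      (equivExterior (negSumSq m) (word l)) = 0 := by
  induction l with
  | nil => simp [word_nil]
  | cons b l ih =>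
    rw [List.nodup_cons] at hl
    obtain ⟨ih1, ih2⟩ := ih hl.2
    have key : equivExterior (negSumSq m) (word (b :: l)) =
        ExteriorAlgebra.ι ℝ (Pi.single b (1 : ℝ)) * equivExterior (negSumSq m) (word l) := by
      have h := changeForm_ι_mul (changeForm.associated_neg_proof (Q := negSumSq m))
        (Pi.single b 1) (word l)
      have h2 := ih2 b hl.1
      simp only [equivExterior, changeFormEquiv_apply] at h2 ⊢
      rw [h2, sub_zero] at h
      rw [word_cons]
      exact h
    refine ⟨by rw [key, ih1]; simp, fun a ha => ?_⟩
    rw [List.mem_cons, not_or] at ha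
    rw [key]
    have h := contractLeft_ι_mul (Q := (0 : QuadraticForm ℝ (Fin m → ℝ)))
      (d := QuadraticMap.associated (R := ℝ) (-negSumSq m) (Pi.single a 1)) (Pi.single b 1)
      (equivExterior (negSumSq m) (word l))
    refine h.trans ?_
    rw [ih2 a ha.2, mul_zero, sub_zero]
    have h0 : (QuadraticMap.associated (R := ℝ) (-negSumSq m) (Pi.single a 1)) (Pi.single b 1)
        = 0 := by
      rw [QuadraticMap.associated_apply]
      simp only [_root_.neg_apply, negSumSq_apply, neg_neg]
      have : ∑ j, (Pi.single a (1 : ℝ) + Pi.single b 1 : Fin m → ℝ) j ^ 2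
          = ∑ j, (Pi.single a (1 : ℝ) : Fin m → ℝ) j ^ 2
            + ∑ j, (Pi.single b (1 : ℝ) : Fin m → ℝ) j ^ 2 := by
        rw [← Finset.sum_add_distrib]
        refine Finset.sum_congr rfl fun k _ => ?_
        by_cases hk : k = a
        · subst hk; simp [ha.1]
        · simp [hk]
      rw [this]
      simp
    rw [h0, zero_smul]

theorem re_word {l : List (Fin m)} (hl : l.Nodup) (h : l ≠ []) : re (word l) = 0 := by
  rw [re, (equivExterior_word hl).1]
  cases l with
  | nil => exact absurd rfl h
  | cons a l => simp [ExteriorAlgebra.algebraMapInv]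

theorem re_basisWord {S : Finset (Fin m)} (h : S ≠ ∅) : re (basisWord S) = 0 :=
  re_word S.nodup_toList (by simpa using h)

theorem re_basisWord_mul_conj (S T : Finset (Fin m)) :
    re (basisWord S * conj (basisWord T)) = if S = T then 1 else 0 := by
  split_ifs with h
  · subst h; exact nsq_word _
  · obtain ⟨e, he⟩ := ((conj_word T.toList).mul_left (basisWord S)).trans (basisWord_mul S T)
    change basisWord S * conj (basisWord T) = _ at he
    rw [he, re_smul, re_basisWord, mul_zero]
    rwa [← Finset.bot_eq_empty, Ne, symmDiff_eq_bot]

/-- The coefficient of `basisWord S`. -/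
def coeff (S : Finset (Fin m)) : Cl m →ₗ[ℝ] ℝ where
  toFun x := re (x * conj (basisWord S))
  map_add' x y := by rw [add_mul, re_add]
  map_smul' r x := by simp [re_smul]

theorem coeff_basisWord (S T : Finset (Fin m)) :
    coeff S (basisWord T) = if T = S then 1 else 0 := re_basisWord_mul_conj T S

/-- The span of the `basisWord S` is a left ideal because generators permute them up to sign. -/
theorem span_basisWord : Submodule.span ℝ (Set.range (basisWord (m := m))) = ⊤ := by
  have hgen : ∀ (v : Fin m → ℝ) (x : Cl m), x ∈ Submodule.span ℝ (Set.range (basisWord (m := m))) →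
      ι (negSumSq m) v * x ∈ Submodule.span ℝ (Set.range (basisWord (m := m))) := by
    intro v x hx
    induction hx using Submodule.span_induction with
    | zero => simp
    | add x y _ _ hx hy => rw [mul_add]; exact add_mem hx hy
    | smul r x _ hx => rw [mul_smul_comm]; exact Submodule.smul_mem _ _ hx
    | mem x hx =>
      obtain ⟨S, rfl⟩ := hx
      have : ι (negSumSq m) v = ∑ j, v j • gen j := by
        conv_lhs => rw [pi_eq_sum_univ' v]
        simp only [map_sum, map_smul]
        rfl
      rw [this, Finset.sum_mul]
      refine sum_mem fun j _ => ?_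
      obtain ⟨e, he⟩ := gen_mul_basisWord j S
      rw [smul_mul_assoc, he]
      exact Submodule.smul_mem _ _ (Submodule.smul_mem _ _ (Submodule.subset_span ⟨_, rfl⟩))
  rw [eq_top_iff]
  rintro x -
  induction x using CliffordAlgebra.left_induction with
  | algebraMap r =>
    rw [Algebra.algebraMap_eq_smul_one, ← basisWord_empty]
    exact Submodule.smul_mem _ _ (Submodule.subset_span ⟨_, rfl⟩)
  | add x y hx hy => exact add_mem hx hy
  | ι_mul x v hx => exact hgen v x hx

theorem eq_sum_coeff (x : Cl m) : x = ∑ S, coeff S x • basisWord S := by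
  have hx : x ∈ Submodule.span ℝ (Set.range (basisWord (m := m))) := by
    rw [span_basisWord]; trivial
  rw [Submodule.mem_span_range_iff_exists_fun] at hx
  obtain ⟨c, rfl⟩ := hx
  refine Finset.sum_congr rfl fun S _ => ?_
  simp [coeff_basisWord]

theorem conj_sum {α : Type*} (s : Finset α) (f : α → Cl m) :
    conj (∑ i ∈ s, f i) = ∑ i ∈ s, conj (f i) := by
  simp [conj]

/-- Positivity of `Re (x x̄)`: it is the sum of the squares of the coefficients of `x`. -/
theorem nsq_eq_sum (x : Cl m) : nsq x = ∑ S, coeff S x ^ 2 := by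
  have h : ∀ y : Cl m, re (y * conj x) = ∑ S, coeff S x * coeff S y := by
    intro y
    conv_lhs => rw [eq_sum_coeff x]
    rw [conj_sum, Finset.mul_sum]
    have hre : ∀ f : Finset (Fin m) → Cl m, re (∑ S, f S) = ∑ S, re (f S) := by
      intro f; simp [re]
    rw [hre]
    refine Finset.sum_congr rfl fun S _ => ?_
    rw [conj_smul, mul_smul_comm, re_smul]
    rfl
  rw [nsq, h]
  exact Finset.sum_congr rfl fun S _ => (sq _).symm

theorem nsq_nonneg (x : Cl m) : 0 ≤ nsq x := by
  rw [nsq_eq_sum]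
  exact Finset.sum_nonneg fun S _ => sq_nonneg _

theorem sq_coeff_le_nsq (S : Finset (Fin m)) (x : Cl m) : coeff S x ^ 2 ≤ nsq x := by
  rw [nsq_eq_sum]
  exact Finset.single_le_sum (f := fun S => coeff S x ^ 2) (fun S _ => sq_nonneg _)
    (Finset.mem_univ S)

theorem nsq_sub_le (x y : Cl m) : nsq (x - y) ≤ 2 * nsq x + 2 * nsq y := by
  have := nsq_add_add_nsq_sub x y
  linarith [nsq_nonneg (x + y)]

/-- The rational Clifford algebra is contained in the rational span of the elements
`(∏ j ∈ S, √d_j) i_S`. -/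
theorem coeff_ratClifford {d : Fin m → ℚ} (hd : ∀ j, 0 < d j) {x : Cl m} (hx : x ∈ ratClifford d)
    (S : Finset (Fin m)) : ∃ q : ℚ, coeff S x = q * ∏ j ∈ S, √(d j : ℝ) := by
  have hword : ∀ w ∈ Submonoid.closure (Set.range fun j => √(d j : ℝ) • (gen j : Cl m)),
      ∃ (T : Finset (Fin m)) (q : ℚ), w = ((q : ℝ) * ∏ j ∈ T, √(d j : ℝ)) • basisWord T := by
    intro w hw
    induction hw using Submonoid.closure_induction_left with
    | one => exact ⟨∅, 1, by simp [basisWord_empty]⟩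
    | mul_left x hx y _ ih =>
      obtain ⟨a, rfl⟩ := hx
      obtain ⟨T, q, rfl⟩ := ih
      obtain ⟨e, he⟩ := gen_mul_basisWord a T
      have hsq : √(d a : ℝ) * √(d a : ℝ) = (d a : ℝ) :=
        Real.mul_self_sqrt (by exact_mod_cast (hd a).le)
      by_cases h : a ∈ T
      · have h2 : symmDiff {a} T = T.erase a := by
          ext x
          by_cases hx : x = a
          · subst hx; simp [Finset.mem_symmDiff, h]
          · simp [Finset.mem_symmDiff, hx]
        refine ⟨T.erase a, q * d a * (e : ℤ), ?_⟩
        dsimp only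
        rw [smul_mul_smul_comm, he, h2, smul_smul, ← Finset.mul_prod_erase T _ h]
        congr 1
        push_cast
        linear_combination (q * (∏ x ∈ T.erase a, √(d x : ℝ)) * ((e : ℤ) : ℝ)) * hsq
      · have h2 : symmDiff {a} T = insert a T := by
          ext x
          by_cases hx : x = a
          · subst hx; simp [Finset.mem_symmDiff, h]
          · simp [Finset.mem_symmDiff, hx]
        refine ⟨insert a T, q * (e : ℤ), ?_⟩
        dsimp only
        rw [smul_mul_smul_comm, he, h2, smul_smul, Finset.prod_insert h]
        congr 1
        push_cast
        ring
  have hx' : x ∈ Submodule.span ℚ (Submonoid.closure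
      (Set.range fun j => √(d j : ℝ) • (gen j : Cl m)) : Set (Cl m)) := by
    rw [← Algebra.adjoin_eq_span]; exact hx
  clear hx
  induction hx' using Submodule.span_induction with
  | zero => exact ⟨0, by simp⟩
  | mem w hw =>
    obtain ⟨T, q, rfl⟩ := hword w hw
    by_cases h : T = S
    · subst h; exact ⟨q, by simp [coeff_basisWord]⟩
    · exact ⟨0, by simp [coeff_basisWord, h]⟩
  | add x y _ _ hx hy =>
    obtain ⟨p, hp⟩ := hx
    obtain ⟨q, hq⟩ := hy
    exact ⟨p + q, by rw [map_add, hp, hq]; push_cast; ring⟩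
  | smul r x _ hx =>
    obtain ⟨p, hp⟩ := hx
    refine ⟨r * p, ?_⟩
    have : (r • x : Cl m) = (r : ℝ) • x := by
      rw [Rat.cast_smul_eq_qsmul]
    rw [this, map_smul, hp]
    push_cast
    simp [mul_assoc]

/-- The coefficients of the elements of an order have a common denominator. -/
theorem exists_denominator {d : Fin m → ℚ} (hd : ∀ j, 0 < d j) {O : Subring (Cl m)}
    (hO : IsStarOrder d O) : ∃ N : ℕ, 0 < N ∧ ∀ x ∈ O, ∀ S, ∃ z : ℤ,
      N * coeff S x = z * ∏ j ∈ S, √(d j : ℝ) := by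
  classical
  obtain ⟨T, hT⟩ := hO.fg
  have hK : ∀ x ∈ O, x ∈ ratClifford d := by
    intro x hx
    have : x ∈ Submodule.span ℚ (O : Set (Cl m)) := Submodule.subset_span hx
    rwa [hO.span] at this
  have hTO : ∀ x ∈ T, x ∈ O := by
    intro x hx
    have : x ∈ AddSubgroup.closure (T : Set (Cl m)) := AddSubgroup.subset_closure hx
    rwa [hT] at this
  have hq : ∀ x : T, ∀ S, ∃ q : ℚ, coeff S (x : Cl m) = q * ∏ j ∈ S, √(d j : ℝ) :=
    fun x S => coeff_ratClifford hd (hK x (hTO x x.2)) S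
  choose q hq using hq
  refine ⟨∏ p : T × Finset (Fin m), (q p.1 p.2).den, Finset.prod_pos fun p _ => (q p.1 p.2).pos,
    ?_⟩
  intro x hx S
  have hx' : x ∈ AddSubgroup.closure (T : Set (Cl m)) := by rw [hT]; exact hx
  clear hx
  induction hx' using AddSubgroup.closure_induction with
  | zero => exact ⟨0, by simp⟩
  | mem x hx =>
    obtain ⟨k, hk⟩ := Finset.dvd_prod_of_mem
      (fun p : T × Finset (Fin m) => (q p.1 p.2).den) (Finset.mem_univ (⟨x, hx⟩, S))
    dsimp only at hk
    refine ⟨k * (q ⟨x, hx⟩ S).num, ?_⟩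
    have h1 : ((q ⟨x, hx⟩ S).den : ℝ) * (q ⟨x, hx⟩ S : ℝ) = (q ⟨x, hx⟩ S).num := by
      exact_mod_cast Rat.den_mul_eq_num (q ⟨x, hx⟩ S)
    rw [hk, hq ⟨x, hx⟩ S]
    push_cast
    linear_combination (k * ∏ j ∈ S, √(d j : ℝ)) * h1
  | add x y _ _ hx hy =>
    obtain ⟨a, ha⟩ := hx
    obtain ⟨b, hb⟩ := hy
    exact ⟨a + b, by rw [map_add, mul_add, ha, hb]; push_cast; ring⟩
  | neg x _ hx =>
    obtain ⟨a, ha⟩ := hx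
    exact ⟨-a, by rw [map_neg, mul_neg, ha]; push_cast; ring⟩

/-- An order has only finitely many elements of bounded absolute value. -/
theorem finite_nsq_le {d : Fin m → ℚ} (hd : ∀ j, 0 < d j) {O : Subring (Cl m)}
    (hO : IsStarOrder d O) (R : ℝ) : {x | x ∈ O ∧ nsq x ≤ R}.Finite := by
  obtain ⟨N, hN, h⟩ := exists_denominator hd hO
  choose! z hz using h
  have hpos : ∀ S : Finset (Fin m), 0 < ∏ j ∈ S, √(d j : ℝ) := fun S =>
    Finset.prod_pos fun j _ => Real.sqrt_pos.mpr (by exact_mod_cast hd j)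
  have hN' : (0 : ℝ) < N := by exact_mod_cast hN
  refine Set.Finite.of_finite_image (f := fun x => fun S => z x S) (Set.Finite.subset
    (Set.Finite.pi' (fun S : Finset (Fin m) => Set.finite_Icc
      (-⌈N * √R / ∏ j ∈ S, √(d j : ℝ)⌉) ⌈N * √R / ∏ j ∈ S, √(d j : ℝ)⌉)) ?_) ?_
  · rintro _ ⟨x, ⟨hx, hR⟩, rfl⟩ S
    have h1 : |coeff S x| ≤ √R := Real.abs_le_sqrt ((sq_coeff_le_nsq S x).trans hR)
    have h2 : |(z x S : ℝ)| ≤ N * √R / ∏ j ∈ S, √(d j : ℝ) := by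
      rw [le_div_iff₀ (hpos S), ← abs_of_pos (hpos S), ← abs_mul, ← hz x hx S, abs_mul,
        abs_of_pos hN']
      exact mul_le_mul_of_nonneg_left h1 hN'.le
    have h3 := h2.trans (Int.le_ceil _)
    rw [Set.mem_Icc, ← abs_le]
    exact_mod_cast h3
  · rintro x ⟨hx, -⟩ y ⟨hy, -⟩ hxy
    rw [eq_sum_coeff x, eq_sum_coeff y]
    refine Finset.sum_congr rfl fun S _ => ?_
    congr 1
    apply mul_left_cancel₀ hN'.ne'
    rw [hz x hx S, hz y hy S, show z x S = z y S from congrFun hxy S]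

/-! ### The group structure on `SL₂` -/

theorem exists_unit_of_ne_zero {c : Cl m} (hc : c ∈ cliffordMonoid m) (h : c ≠ 0) :
    ∃ u ∈ cliffordGroup m, (u : Cl m) = c := hc.resolve_left h

theorem inv_mem_monoid {u : (Cl m)ˣ} (hu : u ∈ cliffordGroup m) :
    ((u⁻¹ : (Cl m)ˣ) : Cl m) ∈ cliffordMonoid m := mem_monoid_of_group (inv_mem hu)

theorem rev_mul_rev_inv (u : (Cl m)ˣ) : rev (u : Cl m) * rev ((u⁻¹ : (Cl m)ˣ) : Cl m) = 1 := by
  rw [← rev_mul, Units.inv_mul, rev_one]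

theorem rev_inv_mul_rev (u : (Cl m)ˣ) : rev ((u⁻¹ : (Cl m)ˣ) : Cl m) * rev (u : Cl m) = 1 := by
  rw [← rev_mul, Units.mul_inv, rev_one]

/-- If `u d*` is a Clifford vector, so is `u⁻¹ d`. -/
theorem inv_mul_mem_Vec {u : (Cl m)ˣ} (hu : u ∈ cliffordGroup m) {d : Cl m}
    (h : u * rev d ∈ Vec m) : ((u⁻¹ : (Cl m)ˣ) : Cl m) * d ∈ Vec m := by
  have h1 := mul_mul_rev_mem_Vec (inv_mem_monoid hu) h
  rw [Units.inv_mul_cancel_left, ← rev_mul] at h1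
  have h2 := rev_of_mem_Vec h1
  rw [rev_rev] at h2
  rwa [h2]

/-- The reversal of `a b*` is `b a*`, and reversal fixes vectors. -/
theorem mul_rev_comm_mem_Vec {a b : Cl m} (h : a * rev b ∈ Vec m) : b * rev a ∈ Vec m := by
  have h2 := rev_of_mem_Vec h
  rw [rev_mul, rev_rev] at h2
  rwa [h2]

theorem IsSL2.rev_pseudoDet {g : Mat m} (h : IsSL2 g) :
    g 1 1 * rev (g 0 0) - g 1 0 * rev (g 0 1) = 1 := by
  have := congrArg rev h.pseudoDet
  simpa [rev_sub, rev_mul, rev_rev, rev_one] using this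

theorem IsSL2.row_mem {g : Mat m} (h : IsSL2 g) (i : Fin 2) : g i 0 * rev (g i 1) ∈ Vec m := by
  fin_cases i
  · exact h.row_zero
  · exact h.row_one

/-- The columns of a matrix in `SL₂` also satisfy a Clifford vector condition. -/
theorem IsSL2.col_mem {g : Mat m} (h : IsSL2 g) (j : Fin 2) {u : (Cl m)ˣ}
    (hu : u ∈ cliffordGroup m) (hj : (u : Cl m) = g 1 j) :
    g 0 j * ((u⁻¹ : (Cl m)ˣ) : Cl m) ∈ Vec m := by
  have hdet := h.rev_pseudoDet
  fin_cases j
  · change (u : Cl m) = g 1 0 at hj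
    have h1 : ((u⁻¹ : (Cl m)ˣ) : Cl m) * g 1 1 ∈ Vec m :=
      inv_mul_mem_Vec hu (by rw [hj]; exact h.row_one)
    have h2 := sub_mem (mul_mul_rev_mem_Vec (h.entries 0 0) h1) h.row_zero
    convert h2 using 1
    have h3 : ((u⁻¹ : (Cl m)ˣ) : Cl m) =
        ((u⁻¹ : (Cl m)ˣ) : Cl m) * g 1 1 * rev (g 0 0) - rev (g 0 1) := by
      rw [← hj] at hdet
      have := congrArg (((u⁻¹ : (Cl m)ˣ) : Cl m) * ·) hdet
      simp only [mul_sub, Units.inv_mul_cancel_left, mul_one] at this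
      rw [mul_assoc]
      exact this.symm
    change g 0 0 * ((u⁻¹ : (Cl m)ˣ) : Cl m) = _
    conv_lhs => rw [h3]
    noncomm_ring
  · change (u : Cl m) = g 1 1 at hj
    have h1 : ((u⁻¹ : (Cl m)ˣ) : Cl m) * g 1 0 ∈ Vec m :=
      inv_mul_mem_Vec hu (by rw [hj]; exact mul_rev_comm_mem_Vec h.row_one)
    have h2 := sub_mem (mul_rev_comm_mem_Vec h.row_zero)
      (mul_mul_rev_mem_Vec (h.entries 0 1) h1)
    convert h2 using 1
    have h3 : ((u⁻¹ : (Cl m)ˣ) : Cl m) =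
        rev (g 0 0) - ((u⁻¹ : (Cl m)ˣ) : Cl m) * g 1 0 * rev (g 0 1) := by
      rw [← hj] at hdet
      have := congrArg (((u⁻¹ : (Cl m)ˣ) : Cl m) * ·) hdet
      simp only [mul_sub, Units.inv_mul_cancel_left, mul_one] at this
      rw [mul_assoc]
      exact this.symm
    change g 0 1 * ((u⁻¹ : (Cl m)ˣ) : Cl m) = _
    conv_lhs => rw [h3]
    noncomm_ring

theorem mat_mul_apply (g h : Mat m) (i j : Fin 2) :
    (g * h) i j = g i 0 * h 0 j + g i 1 * h 1 j := by
  rw [Matrix.mul_apply, Fin.sum_univ_two]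

/-- Product entries lie in the Clifford monoid: `a p + b r = a (a⁻¹ b + p r⁻¹) r` is a product of
two elements of the Clifford group and a vector. -/
theorem IsSL2.mul_entries {g h : Mat m} (hg : IsSL2 g) (hh : IsSL2 h) (i j : Fin 2) :
    (g * h) i j ∈ cliffordMonoid m := by
  rw [mat_mul_apply]
  by_cases ha : g i 0 = 0
  · rw [ha, zero_mul, zero_add]
    exact mul_mem_monoid (hg.entries _ _) (hh.entries _ _)
  by_cases hr : h 1 j = 0
  · rw [hr, mul_zero, add_zero]
    exact mul_mem_monoid (hg.entries _ _) (hh.entries _ _)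
  obtain ⟨s, hs, hsa⟩ := exists_unit_of_ne_zero (hg.entries i 0) ha
  obtain ⟨u, hu, hur⟩ := exists_unit_of_ne_zero (hh.entries 1 j) hr
  have h1 : ((s⁻¹ : (Cl m)ˣ) : Cl m) * g i 1 ∈ Vec m :=
    inv_mul_mem_Vec hs (by rw [hsa]; exact hg.row_mem i)
  have h2 := hh.col_mem j hu hur
  have h3 : g i 0 * h 0 j + g i 1 * h 1 j =
      s * (((s⁻¹ : (Cl m)ˣ) : Cl m) * g i 1 + h 0 j * ((u⁻¹ : (Cl m)ˣ) : Cl m)) * u := by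
    rw [← hsa, ← hur, mul_add, add_mul, Units.mul_inv_cancel_left]
    simp only [mul_assoc, Units.inv_mul, mul_one]
    rw [add_comm]
  rw [h3]
  exact mul_mem_monoid (mul_mem_monoid (mem_monoid_of_group hs) (vec_mem_monoid (add_mem h1 h2)))
    (mem_monoid_of_group hu)

/-- Products satisfy the row conditions. Apart from terms of the form `u x u*`, the product
`(a p + b r)(a q + b s)*` contains the symmetric sum of `a q r* b*` and its reversal, which reduces
to the polarized product of three vectors `p r⁻¹`, `r s*` and `a⁻¹ b`. -/
theorem IsSL2.mul_row {g h : Mat m} (hg : IsSL2 g) (hh : IsSL2 h) (i : Fin 2) :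
    (g * h) i 0 * rev ((g * h) i 1) ∈ Vec m := by
  rw [mat_mul_apply, mat_mul_apply]
  have hdet := hh.pseudoDet
  have hga := hg.entries i 0
  have hgb := hg.entries i 1
  have hgr := hg.row_mem i
  set a := g i 0
  set b := g i 1
  have key : a * h 0 1 * rev (h 1 0) * rev b + b * h 1 0 * rev (h 0 1) * rev a ∈ Vec m := by
    by_cases ha : a = 0
    · simp [ha, rev_zero]
    by_cases hr : h 1 0 = 0
    · simp [hr, rev_zero]
    obtain ⟨s, hs, hsa⟩ := exists_unit_of_ne_zero hga ha
    obtain ⟨u, hu, hur⟩ := exists_unit_of_ne_zero (hh.entries 1 0) hr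
    have hP : ((s⁻¹ : (Cl m)ˣ) : Cl m) * b ∈ Vec m :=
      inv_mul_mem_Vec hs (by rw [hsa]; exact hgr)
    have hQ := hh.col_mem 0 hu hur
    have hR := hh.row_one
    rw [← mem_Vec] at hR
    have hb : b = s * (((s⁻¹ : (Cl m)ˣ) : Cl m) * b) := by rw [Units.mul_inv_cancel_left]
    have hrb : rev b = ((s⁻¹ : (Cl m)ˣ) : Cl m) * b * rev a := by
      conv_lhs => rw [hb, rev_mul, rev_of_mem_Vec hP, hsa]
    set P := ((s⁻¹ : (Cl m)ˣ) : Cl m) * b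
    set q := h 0 0 * ((u⁻¹ : (Cl m)ˣ) : Cl m) with hq
    set R := h 1 0 * rev (h 1 1) with hRdef
    have hqR : h 0 1 * rev (h 1 0) = q * R - 1 := by
      have : h 0 0 * rev (h 1 1) = q * R := by
        rw [hq, hRdef, ← hur, mul_assoc, Units.inv_mul_cancel_left]
      rw [← this, ← hdet]
      abel
    have hRq : h 1 0 * rev (h 0 1) = R * q - 1 := by
      have := congrArg rev hqR
      rwa [rev_mul, rev_rev, rev_sub, rev_mul, rev_of_mem_Vec hR, rev_of_mem_Vec hQ, rev_one]
        at this
    have : a * h 0 1 * rev (h 1 0) * rev b + b * h 1 0 * rev (h 0 1) * rev a =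
        a * ((q * R * P + P * R * q) - (2 : ℝ) • P) * rev a := by
      rw [mul_assoc a, hqR, mul_assoc b, hRq, hrb, hb, hsa, two_smul]
      noncomm_ring
    rw [this]
    exact mul_mul_rev_mem_Vec hga (sub_mem (mul_mul_add_mem_Vec hQ hP hR)
      (Submodule.smul_mem _ _ hP))
  have h1 : (a * h 0 0 + b * h 1 0) * rev (a * h 0 1 + b * h 1 1) =
      a * (h 0 0 * rev (h 0 1)) * rev a + b * (h 1 0 * rev (h 1 1)) * rev b + a * rev b +
      (a * h 0 1 * rev (h 1 0) * rev b + b * h 1 0 * rev (h 0 1) * rev a) := by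
    have : a * rev b = a * (h 0 0 * rev (h 1 1) - h 0 1 * rev (h 1 0)) * rev b := by
      rw [hdet, mul_one]
    rw [this, rev_add, rev_mul, rev_mul]
    noncomm_ring
  rw [h1]
  exact add_mem (add_mem (add_mem (mul_mul_rev_mem_Vec hga hh.row_zero)
    (mul_mul_rev_mem_Vec hgb hh.row_one)) hgr) key

theorem IsSL2.mul_rev_comm {g : Mat m} (hg : IsSL2 g) (i : Fin 2) :
    g i 0 * rev (g i 1) = g i 1 * rev (g i 0) := by
  have := rev_of_mem_Vec (hg.row_mem i)
  rwa [rev_mul, rev_rev, eq_comm] at this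

theorem IsSL2.mul {g h : Mat m} (hg : IsSL2 g) (hh : IsSL2 h) : IsSL2 (g * h) where
  entries := hg.mul_entries hh
  row_zero := hg.mul_row hh 0
  row_one := hg.mul_row hh 1
  pseudoDet := by
    simp only [mat_mul_apply]
    have h1 : (g 0 0 * h 0 0 + g 0 1 * h 1 0) * rev (g 1 0 * h 0 1 + g 1 1 * h 1 1) -
        (g 0 0 * h 0 1 + g 0 1 * h 1 1) * rev (g 1 0 * h 0 0 + g 1 1 * h 1 0) =
        g 0 0 * (h 0 0 * rev (h 0 1) - h 0 1 * rev (h 0 0)) * rev (g 1 0) +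
        g 0 1 * (h 1 0 * rev (h 1 1) - h 1 1 * rev (h 1 0)) * rev (g 1 1) +
        g 0 0 * (h 0 0 * rev (h 1 1) - h 0 1 * rev (h 1 0)) * rev (g 1 1) -
        g 0 1 * (h 1 1 * rev (h 0 0) - h 1 0 * rev (h 0 1)) * rev (g 1 0) := by
      simp only [rev_add, rev_mul]
      noncomm_ring
    rw [h1, hh.mul_rev_comm 0, hh.mul_rev_comm 1, hh.pseudoDet, hh.rev_pseudoDet]
    simpa using hg.pseudoDet

/-- The inverse `(d* -b*; -c* a*)` of `(a b; c d)`. -/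
def ginv (g : Mat m) : Mat m := !![rev (g 1 1), -rev (g 0 1); -rev (g 1 0), rev (g 0 0)]

theorem ginv_ginv (g : Mat m) : ginv (ginv g) = g := by
  ext i j
  fin_cases i <;> fin_cases j <;> simp [ginv, rev_neg, rev_rev]

theorem IsSL2.rev_mul_mem {g : Mat m} (h : IsSL2 g) (j : Fin 2) :
    rev (g 1 j) * g 0 j ∈ Vec m := by
  by_cases h0 : g 1 j = 0
  · simp [h0, rev_zero]
  obtain ⟨u, hu, huj⟩ := exists_unit_of_ne_zero (h.entries 1 j) h0
  have := rev_mul_mul_mem_Vec (mem_monoid_of_group hu) (h.col_mem j hu huj)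
  rwa [mul_assoc, mul_assoc, Units.inv_mul, mul_one, huj] at this

theorem IsSL2.pseudoDet_ginv {g : Mat m} (h : IsSL2 g) :
    rev (g 1 1) * g 0 0 - rev (g 0 1) * g 1 0 = 1 := by
  by_cases h0 : g 1 0 = 0
  · have hd := h.pseudoDet
    rw [h0, rev_zero, mul_zero, sub_zero] at hd
    have ha : g 0 0 ≠ 0 := by
      intro ha
      rw [ha, zero_mul] at hd
      exact zero_ne_one hd
    obtain ⟨u, hu, hua⟩ := exists_unit_of_ne_zero (h.entries 0 0) ha
    rw [h0, mul_zero, sub_zero, ← hua]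
    rw [← hua] at hd
    rw [← u.inv_mul_cancel_left (rev (g 1 1)), hd, mul_one, Units.inv_mul]
  · obtain ⟨u, hu, huc⟩ := exists_unit_of_ne_zero (h.entries 1 0) h0
    have hv : ((u⁻¹ : (Cl m)ˣ) : Cl m) * g 1 1 ∈ Vec m :=
      inv_mul_mem_Vec hu (by rw [huc]; exact h.row_one)
    have hsym : rev (g 0 0) * u = rev (u : Cl m) * g 0 0 := by
      have := rev_of_mem_Vec (h.rev_mul_mem 0)
      rwa [rev_mul, rev_rev, ← huc] at this
    have hb : rev (g 0 1) = ((u⁻¹ : (Cl m)ˣ) : Cl m) * (g 1 1 * rev (g 0 0) - 1) := by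
      rw [← h.rev_pseudoDet, sub_sub_cancel, ← huc, Units.inv_mul_cancel_left]
    have hd : rev (g 1 1) = ((u⁻¹ : (Cl m)ˣ) : Cl m) * g 1 1 * rev (u : Cl m) := by
      conv_rhs => rw [← rev_of_mem_Vec hv, rev_mul, mul_assoc, rev_inv_mul_rev, mul_one]
    rw [hb, hd, ← huc, mul_sub, sub_mul, mul_one, Units.inv_mul, mul_assoc, ← hsym]
    noncomm_ring

theorem IsSL2.inv {g : Mat m} (h : IsSL2 g) : IsSL2 (ginv g) where
  entries i j := by
    fin_cases i <;> fin_cases j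
    · exact rev_mem_monoid (h.entries 1 1)
    · exact neg_mem_monoid (rev_mem_monoid (h.entries 0 1))
    · exact neg_mem_monoid (rev_mem_monoid (h.entries 1 0))
    · exact rev_mem_monoid (h.entries 0 0)
  row_zero := by
    have := neg_mem (h.rev_mul_mem 1)
    rw [← mem_Vec]
    simpa [ginv, rev_neg, rev_rev] using this
  row_one := by
    have := neg_mem (h.rev_mul_mem 0)
    rw [← mem_Vec]
    simpa [ginv, rev_neg, rev_rev] using this
  pseudoDet := by
    simpa [ginv, rev_neg, rev_rev] using h.pseudoDet_ginv

theorem IsSL2.mul_ginv {g : Mat m} (h : IsSL2 g) : g * ginv g = 1 := by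
  ext i j
  rw [mat_mul_apply]
  fin_cases i <;> fin_cases j
  · simpa [ginv, sub_eq_add_neg] using h.pseudoDet
  · simp [ginv, h.mul_rev_comm 0]
  · simp [ginv, h.mul_rev_comm 1]
  · simpa [ginv, sub_eq_neg_add] using h.rev_pseudoDet

theorem IsSL2.ginv_mul {g : Mat m} (h : IsSL2 g) : ginv g * g = 1 := by
  simpa [ginv_ginv] using h.inv.mul_ginv

/-- The matrix of the inversion `x ↦ -x⁻¹`. -/
def inversion : Mat m := !![0, -1; 1, 0]

theorem isSL2_inversion : IsSL2 (inversion : Mat m) where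
  entries i j := by
    fin_cases i <;> fin_cases j
    · exact zero_mem_monoid
    · exact neg_mem_monoid one_mem_monoid
    · exact one_mem_monoid
    · exact zero_mem_monoid
  row_zero := ⟨0, by simp [inversion, vec_zero]⟩
  row_one := ⟨0, by simp [inversion, vec_zero, rev_zero]⟩
  pseudoDet := by simp [inversion, rev_one]

section order

variable {O : Subring (Cl m)}

theorem mul_mem_SL2 {g h : Mat m} (hg : g ∈ SL2 O) (hh : h ∈ SL2 O) : g * h ∈ SL2 O :=
  ⟨hg.1.mul hh.1, fun i j => by
    rw [mat_mul_apply]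
    exact add_mem (mul_mem (hg.2 _ _) (hh.2 _ _)) (mul_mem (hg.2 _ _) (hh.2 _ _))⟩

theorem ginv_mem_SL2 (hO : ∀ x ∈ O, rev x ∈ O) {g : Mat m} (hg : g ∈ SL2 O) : ginv g ∈ SL2 O := by
  refine ⟨hg.1.inv, fun i j => ?_⟩
  fin_cases i <;> fin_cases j
  · exact hO _ (hg.2 _ _)
  · exact neg_mem (hO _ (hg.2 _ _))
  · exact neg_mem (hO _ (hg.2 _ _))
  · exact hO _ (hg.2 _ _)

theorem inversion_mem_SL2 : (inversion : Mat m) ∈ SL2 O := by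
  refine ⟨isSL2_inversion, fun i j => ?_⟩
  fin_cases i <;> fin_cases j
  · exact zero_mem _
  · exact neg_mem (one_mem _)
  · exact one_mem _
  · exact zero_mem _

theorem one_mem_SL2 : (1 : Mat m) ∈ SL2 O := by
  have h := mul_mem_SL2 (O := O) inversion_mem_SL2 inversion_mem_SL2
  have h' := mul_mem_SL2 h h
  convert h' using 1
  ext i j
  fin_cases i <;> fin_cases j <;> simp [inversion]

/-- Swapping the columns: if `(c, d)` is unimodular, so is `(d, -c)`. -/
theorem Unimodular.swap {c d : Cl m} (h : Unimodular O c d) : Unimodular O d (-c) := by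
  obtain ⟨g, hg, rfl, rfl⟩ := h
  refine ⟨g * inversion, mul_mem_SL2 hg inversion_mem_SL2, ?_, ?_⟩ <;>
    simp [mat_mul_apply, inversion]

end order

/-! ### Möbius transformations of Clifford vectors -/

theorem den_mem_monoid {c d x : Cl m} (hc : c ∈ cliffordMonoid m) (hd : d ∈ cliffordMonoid m)
    (hcd : c * rev d ∈ Vec m) (hx : x ∈ Vec m) : c * x + d ∈ cliffordMonoid m := by
  by_cases h : c = 0
  · simpa [h] using hd
  obtain ⟨u, hu, rfl⟩ := exists_unit_of_ne_zero hc h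
  have h1 : (u : Cl m) * x + d = u * (x + ((u⁻¹ : (Cl m)ˣ) : Cl m) * d) := by
    rw [mul_add, Units.mul_inv_cancel_left]
  rw [h1]
  exact mul_mem_monoid hc (vec_mem_monoid (add_mem hx (inv_mul_mem_Vec hu hcd)))

theorem inverse_mul_cancel {q : Cl m} (hq : q ∈ cliffordMonoid m) (h : q ≠ 0) :
    Ring.inverse q * q = 1 := by
  obtain ⟨u, -, rfl⟩ := exists_unit_of_ne_zero hq h
  simp

/-- Möbius transformations map vectors to vectors (or to `∞`). -/
theorem IsSL2.moebius_mem_Vec {g : Mat m} (h : IsSL2 g) {x : Cl m} (hx : x ∈ Vec m)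
    (hq : g 1 0 * x + g 1 1 ≠ 0) : moebius g x ∈ Vec m := by
  rw [moebius]
  by_cases hc : g 1 0 = 0
  · have hdet := h.pseudoDet
    rw [hc, zero_mul, zero_add] at hq
    obtain ⟨u, hu, hud⟩ := exists_unit_of_ne_zero (h.entries 1 1) hq
    have ha : g 0 0 = rev ((u⁻¹ : (Cl m)ˣ) : Cl m) := by
      rw [hc, rev_zero, mul_zero, sub_zero, ← hud] at hdet
      have := congrArg (· * rev ((u⁻¹ : (Cl m)ˣ) : Cl m)) hdet
      simpa only [mul_assoc, rev_mul_rev_inv, mul_one, one_mul] using this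
    rw [hc, zero_mul, zero_add, ← hud, Ring.inverse_unit, add_mul, ha]
    exact add_mem (rev_mul_mul_mem_Vec (inv_mem_monoid hu) hx) (h.col_mem 1 hu hud)
  · obtain ⟨u, hu, huc⟩ := exists_unit_of_ne_zero (h.entries 1 0) hc
    have hv : ((u⁻¹ : (Cl m)ˣ) : Cl m) * g 1 1 ∈ Vec m :=
      inv_mul_mem_Vec hu (by rw [huc]; exact h.row_one)
    have hden : g 1 0 * x + g 1 1 = u * (x + ((u⁻¹ : (Cl m)ˣ) : Cl m) * g 1 1) := by
      rw [mul_add, Units.mul_inv_cancel_left, huc]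
    have hw0 : x + ((u⁻¹ : (Cl m)ˣ) : Cl m) * g 1 1 ≠ 0 := by
      intro h0
      rw [h0, mul_zero] at hden
      exact hq hden
    obtain ⟨w, hw, hwx⟩ := exists_unit_of_ne_zero (vec_mem_monoid (add_mem hx hv)) hw0
    have hwinv : ((w⁻¹ : (Cl m)ˣ) : Cl m) ∈ Vec m := by
      obtain ⟨y, hy⟩ := mem_Vec.mp (add_mem hx hv)
      exact unit_vec_inv (hwx.trans hy)
    have hb : g 0 1 =
        g 0 0 * (((u⁻¹ : (Cl m)ˣ) : Cl m) * g 1 1) - rev ((u⁻¹ : (Cl m)ˣ) : Cl m) := by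
      have h1 : rev (((u⁻¹ : (Cl m)ˣ) : Cl m) * g 1 1) =
        rev (g 1 1) * rev ((u⁻¹ : (Cl m)ˣ) : Cl m) := rev_mul _ _
      have h2 := congrArg (· * rev ((u⁻¹ : (Cl m)ˣ) : Cl m)) h.pseudoDet
      simp only [sub_mul, mul_assoc, ← huc, rev_mul_rev_inv, mul_one, one_mul] at h2
      rw [← rev_of_mem_Vec hv, h1]
      exact eq_sub_of_add_eq ((add_comm _ _).trans (sub_eq_iff_eq_add.mp h2).symm)
    have hnum : g 0 0 * x + g 0 1 = g 0 0 * w - rev ((u⁻¹ : (Cl m)ˣ) : Cl m) := by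
      rw [hwx, hb]
      noncomm_ring
    rw [hden, ← hwx, ← Units.val_mul, Ring.inverse_unit, hnum, mul_inv_rev, Units.val_mul,
      sub_mul, mul_assoc, Units.mul_inv_cancel_left]
    refine sub_mem (h.col_mem 0 hu huc) ?_
    rw [← mul_assoc]
    exact rev_mul_mul_mem_Vec (inv_mem_monoid hu) hwinv

/-- The cocycle rule for rows: if `y = h x`, the row `i` of `g h` takes at `x` the value of the row
`i` of `g` at `y`, times the denominator of `h` at `x`. -/
theorem row_mul_moebius {g h : Mat m} {x : Cl m}
    (hq : h 1 0 * x + h 1 1 ∈ cliffordMonoid m) (hq0 : h 1 0 * x + h 1 1 ≠ 0) (i : Fin 2) :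
    (g * h) i 0 * x + (g * h) i 1 = (g i 0 * moebius h x + g i 1) * (h 1 0 * x + h 1 1) := by
  have h1 : moebius h x * (h 1 0 * x + h 1 1) = h 0 0 * x + h 0 1 := by
    rw [moebius, mul_assoc, inverse_mul_cancel hq hq0, mul_one]
  rw [mat_mul_apply, mat_mul_apply, add_mul (g i 0 * moebius h x), mul_assoc (g i 0) (moebius h x),
    h1]
  noncomm_ring

theorem moebius_mul {g h : Mat m} {x : Cl m}
    (hq : h 1 0 * x + h 1 1 ∈ cliffordMonoid m) (hq0 : h 1 0 * x + h 1 1 ≠ 0)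
    (hr : g 1 0 * moebius h x + g 1 1 ∈ cliffordMonoid m)
    (hr0 : g 1 0 * moebius h x + g 1 1 ≠ 0) :
    moebius (g * h) x = moebius g (moebius h x) := by
  rw [moebius, row_mul_moebius hq hq0, row_mul_moebius hq hq0, moebius.eq_1 g]
  obtain ⟨u, -, hu⟩ := exists_unit_of_ne_zero hq hq0
  obtain ⟨v, -, hv⟩ := exists_unit_of_ne_zero hr hr0
  rw [← hu, ← hv, ← Units.val_mul, Ring.inverse_unit, Ring.inverse_unit, mul_inv_rev,
    Units.val_mul, mul_assoc, Units.mul_inv_cancel_left]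

/-! ### The embedding of `Cl m` into `Cl (m + 1)` -/

theorem incl_ι (v : Fin m → ℝ) :
    incl m (ι (negSumSq m) v) = ι (negSumSq (m + 1)) (Fin.snoc v 0 : Fin (m + 1) → ℝ) :=
  map_apply_ι _ _

theorem incl_rev (x : Cl m) : incl m (rev x) = rev (incl m x) := by
  induction x using CliffordAlgebra.induction with
  | algebraMap r => simp [rev, reverse.commutes]
  | ι v => rw [incl_ι]; simp [rev, incl_ι]
  | mul a b ha hb => rw [rev_mul, map_mul, map_mul, rev_mul, ha, hb]
  | add a b ha hb => rw [rev_add, map_add, map_add, rev_add, ha, hb]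

theorem incl_involute (x : Cl m) : incl m (involute x) = involute (incl m x) := by
  induction x using CliffordAlgebra.induction with
  | algebraMap r => simp
  | ι v => rw [incl_ι]; simp [incl_ι]
  | mul a b ha hb => simp only [map_mul, ha, hb]
  | add a b ha hb => simp only [map_add, ha, hb]

theorem incl_conj (x : Cl m) : incl m (conj x) = conj (incl m x) := by
  rw [conj_eq, incl_rev, incl_involute, conj_eq]

/-- The embedding of `V m` into `V (m + 1)` with last coordinate `0`. -/
def extend (x : V m) : V (m + 1) := WithLp.toLp 2 (Fin.snoc (fun j => x j) 0)

theorem extend_last (x : V m) : extend x (Fin.last (m + 1)) = 0 := by simp [extend]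

theorem extend_castSucc (x : V m) (j : Fin (m + 1)) : extend x j.castSucc = x j := by simp [extend]

theorem incl_vec (x : V m) : incl m (vec x) = vec (extend x) := by
  rw [vec_apply, map_add, incl_ι, AlgHom.commutes, vec_apply]
  congr 2
  ext j
  refine Fin.lastCases ?_ (fun i => ?_) j
  · rw [Fin.snoc_last, Fin.succ_last, extend_last]
  · rw [Fin.snoc_castSucc, Fin.succ_castSucc, extend_castSucc]

theorem incl_mem_Vec {x : Cl m} (hx : x ∈ Vec m) : incl m x ∈ Vec (m + 1) := by
  obtain ⟨y, rfl⟩ := hx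
  exact ⟨_, incl_vec y⟩

theorem incl_mem_monoid {x : Cl m} (hx : x ∈ cliffordMonoid m) :
    incl m x ∈ cliffordMonoid (m + 1) := by
  rcases hx with rfl | ⟨u, hu, rfl⟩
  · simpa using zero_mem_monoid
  refine cliffordGroup_induction ?_ (fun u v hu ih => ?_) hu
  · simpa using one_mem_monoid
  · rw [Units.val_mul, map_mul]
    exact mul_mem_monoid (vec_mem_monoid (incl_mem_Vec hu)) ih

theorem nsq_incl {x : Cl m} (hx : x ∈ cliffordMonoid m) : nsq (incl m x) = nsq x := by
  rw [nsq, ← incl_conj, ← map_mul, mul_conj hx, AlgHom.commutes, re_algebraMap]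

theorem incl_ne_zero {x : Cl m} (hx : x ∈ cliffordMonoid m) (h : x ≠ 0) : incl m x ≠ 0 := by
  intro h0
  have := nsq_incl hx
  rw [h0, nsq_zero] at this
  exact (nsq_pos hx h).ne this

theorem IsSL2.map_incl {g : Mat m} (h : IsSL2 g) : IsSL2 (g.map (incl m)) where
  entries i j := incl_mem_monoid (h.entries i j)
  row_zero := by
    rw [← mem_Vec]
    have := incl_mem_Vec h.row_zero
    rwa [map_mul, incl_rev] at this
  row_one := by
    rw [← mem_Vec]
    have := incl_mem_Vec h.row_one
    rwa [map_mul, incl_rev] at this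
  pseudoDet := by
    have := congrArg (incl m) h.pseudoDet
    rwa [map_sub, map_mul, map_mul, incl_rev, incl_rev, map_one] at this

theorem inclMap_mul (g h : Mat m) :
    (g * h).map (incl m) = g.map (incl m) * h.map (incl m) :=
  Matrix.map_mul

/-- The last generator of `Cl (m + 1)`. -/
def lastGen (m : ℕ) : Cl (m + 1) := gen (Fin.last m)

theorem lastGen_mul_incl (y : Cl m) :
    lastGen m * incl m y = incl m (involute y) * lastGen m := by
  induction y using CliffordAlgebra.induction with
  | algebraMap r => simp only [AlgHom.commutes]; exact (Algebra.commutes _ _).symm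
  | ι v =>
    rw [involute_ι, map_neg, incl_ι, neg_mul]
    refine ι_mul_ι_comm_of_isOrtho ?_
    rw [QuadraticMap.isOrtho_def]
    simp only [negSumSq_apply, Fin.sum_univ_castSucc]
    simp [(Fin.castSucc_lt_last _).ne, add_comm]
  | mul a b ha hb =>
    rw [map_mul, map_mul, map_mul, ← mul_assoc, ha, mul_assoc, hb, mul_assoc]
  | add a b ha hb => rw [map_add, map_add, map_add, mul_add, ha, hb, add_mul]

theorem vec_eq_extend_add (y : V (m + 1)) :
    vec y = incl m (vec (WithLp.toLp 2 fun j => y j.castSucc)) +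
      y (Fin.last (m + 1)) • lastGen m := by
  have h : lastGen m = vec (WithLp.toLp 2 (Pi.single (Fin.last (m + 1)) 1)) := by
    rw [vec_apply, lastGen, gen]
    have h1 : (fun j : Fin (m + 1) =>
        (Pi.single (Fin.last (m + 1)) (1 : ℝ) : Fin (m + 2) → ℝ) j.succ) =
        Pi.single (Fin.last m) 1 := by
      ext j
      by_cases hj : j = Fin.last m
      · subst hj; simp
      · rw [Pi.single_eq_of_ne hj, Pi.single_eq_of_ne]
        rw [← Fin.succ_last]
        exact fun h => hj (Fin.succ_injective _ h)
    have h0 : (Pi.single (Fin.last (m + 1)) (1 : ℝ) : Fin (m + 2) → ℝ) 0 = 0 :=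
      Pi.single_eq_of_ne (Fin.last_pos.ne) _
    change _ = algebraMap ℝ _ ((Pi.single (Fin.last (m + 1)) (1 : ℝ) : Fin (m + 2) → ℝ) 0) +
      ι (negSumSq (m + 1)) (fun j : Fin (m + 1) =>
        (Pi.single (Fin.last (m + 1)) (1 : ℝ) : Fin (m + 2) → ℝ) j.succ)
    rw [h0, h1, map_zero, zero_add]
  rw [h, incl_vec, ← vec_smul, ← vec_add]
  congr 1
  ext j
  refine Fin.lastCases ?_ (fun i => ?_) j
  · simp [extend_last]
  · simp [extend_castSucc, (Fin.castSucc_lt_last i).ne]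

/-- `Cl m` contains no nonzero multiple of the last generator `e` of `Cl (m + 1)`: elements `y` of
`Cl m` satisfy `e y = y' e`, with `y'` the main involution, whereas `e' e = -e e`. -/
theorem eq_zero_of_smul_lastGen {r : ℝ} {z : Cl m} (h : r • lastGen m = incl m z) : r = 0 := by
  have h1 := lastGen_mul_incl z
  rw [incl_involute, ← h, map_smul] at h1
  have h2 : involute (lastGen m) = -lastGen m := involute_ι _
  have h3 : lastGen m * lastGen m = -1 := gen_mul_self _
  rw [h2, mul_smul_comm, smul_mul_assoc, neg_mul, h3, neg_neg] at h1
  have h4 := congrArg re h1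
  rw [re_smul, re_smul, re_neg] at h4
  have h5 : re (1 : Cl (m + 1)) = 1 := by simpa using re_algebraMap (m := m + 1) 1
  rw [h5] at h4
  linarith

theorem last_and_proj_eq {y : V (m + 1)} {z : Cl m} {r : ℝ}
    (h : vec y = incl m z + r • lastGen m) :
    y (Fin.last (m + 1)) = r ∧
      incl m (vec (WithLp.toLp 2 fun j => y j.castSucc)) = incl m z := by
  rw [vec_eq_extend_add] at h
  have h1 : (y (Fin.last (m + 1)) - r) • lastGen m =
      incl m (z - vec (WithLp.toLp 2 fun j => y j.castSucc)) := by
    rw [map_sub, sub_smul, sub_eq_sub_iff_add_eq_add]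
    exact (add_comm _ _).trans h
  have h2 := sub_eq_zero.mp (eq_zero_of_smul_lastGen h1)
  exact ⟨h2, by rwa [h2, add_left_inj] at h⟩

/-! ### Heights and the action on hyperbolic space -/

/-- The height of a point of hyperbolic space. -/
abbrev height (x : Hyp m) : ℝ := x.1 (Fin.last (m + 1))

/-- The value `c x + d` at a point of hyperbolic space, computed in `Cl (m + 1)`. -/
def den (c d : Cl m) (x : Hyp m) : Cl (m + 1) := incl m c * vec x.1 + incl m d

/-- Rows of matrices in `SL₂`: pairs in the Clifford monoid with `c d*` a vector. -/
structure IsRow (c d : Cl m) : Prop where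
  left : c ∈ cliffordMonoid m
  right : d ∈ cliffordMonoid m
  mem : c * rev d ∈ Vec m

theorem IsSL2.isRow {g : Mat m} (h : IsSL2 g) (i : Fin 2) : IsRow (g i 0) (g i 1) :=
  ⟨h.entries i 0, h.entries i 1, h.row_mem i⟩

theorem IsSL2.bottom_ne_zero {g : Mat m} (h : IsSL2 g) : g 1 0 ≠ 0 ∨ g 1 1 ≠ 0 := by
  by_contra! h0
  have := h.pseudoDet
  rw [h0.1, h0.2, rev_zero] at this
  simp at this

theorem IsRow.den_mem {c d : Cl m} (h : IsRow c d) (x : Hyp m) :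
    den c d x ∈ cliffordMonoid (m + 1) := by
  refine den_mem_monoid (incl_mem_monoid h.left) (incl_mem_monoid h.right) ?_ (vec_mem _)
  have := incl_mem_Vec h.mem
  rwa [map_mul, incl_rev] at this

/-- If `c ≠ 0`, then `c x + d = c (x - p)` with `p = -c⁻¹ d` a point of the boundary. -/
theorem IsRow.exists_center {c d : Cl m} (h : IsRow c d) (hc : c ≠ 0) :
    ∃ p : V m, vec p = -(Ring.inverse c * d) ∧
      ∀ x : Hyp m, den c d x = incl m c * vec (x.1 - extend p) := by
  obtain ⟨u, hu, rfl⟩ := exists_unit_of_ne_zero h.left hc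
  obtain ⟨p, hp⟩ := mem_Vec.mp (neg_mem (inv_mul_mem_Vec hu h.mem))
  refine ⟨p, by rw [← hp, Ring.inverse_unit], fun x => ?_⟩
  rw [vec_sub, ← incl_vec, ← hp, map_neg, sub_neg_eq_add, den, mul_add, ← map_mul,
    Units.mul_inv_cancel_left]

theorem nsq_den_of_center {c d : Cl m} (hc : c ∈ cliffordMonoid m) {p : V m} {x : Hyp m}
    (h : den c d x = incl m c * vec (x.1 - extend p)) :
    nsq (den c d x) = nsq c * ‖x.1 - extend p‖ ^ 2 := by
  rw [h, nsq_mul _ (vec_mem_monoid (vec_mem _)), nsq_incl hc, nsq_vec]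

theorem norm_sq_sub_extend (x : Hyp m) (p : V m) :
    ‖x.1 - extend p‖ ^ 2 = ‖proj x - p‖ ^ 2 + height x ^ 2 := by
  rw [EuclideanSpace.norm_sq_eq, EuclideanSpace.norm_sq_eq, Fin.sum_univ_castSucc]
  simp [extend_castSucc, extend_last, proj]

/-- The centre of the sphere `|c x + d| = 1` lies in the boundary, so `|c x + d| = |c| |x - p|` is at
least `|c|` times the height of `x`. -/
theorem IsRow.nsq_mul_height_le {c d : Cl m} (h : IsRow c d) (x : Hyp m) :
    nsq c * height x ^ 2 ≤ nsq (den c d x) := by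
  by_cases hc : c = 0
  · rw [hc, nsq_zero, zero_mul]
    exact nsq_nonneg _
  · obtain ⟨p, -, hp⟩ := h.exists_center hc
    rw [nsq_den_of_center h.left (hp x), norm_sq_sub_extend]
    exact mul_le_mul_of_nonneg_left (by linarith [sq_nonneg ‖proj x - p‖]) (nsq_nonneg _)

theorem IsRow.den_ne_zero {c d : Cl m} (h : IsRow c d) (h0 : c ≠ 0 ∨ d ≠ 0) (x : Hyp m) :
    den c d x ≠ 0 := by
  by_cases hc : c = 0
  · rw [den, hc, map_zero, zero_mul, zero_add]
    exact incl_ne_zero h.right (h0.resolve_left (not_not.mpr hc))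
  · intro h1
    have := h.nsq_mul_height_le x
    rw [h1, nsq_zero] at this
    have hx := x.2
    have h2 := nsq_pos h.left hc
    have : 0 < nsq c * height x ^ 2 := by positivity
    linarith

theorem IsSL2.den_ne_zero {g : Mat m} (h : IsSL2 g) (x : Hyp m) :
    den (g 1 0) (g 1 1) x ≠ 0 := (h.isRow 1).den_ne_zero h.bottom_ne_zero x

/-- The product `(a x + b) \overline{(c x + d)}` for `x = v + t i_n` is the sum of an element of
the smaller Clifford algebra and `t` times the last generator, because the coefficient of the
latter is the pseudo-determinant. -/
theorem IsSL2.num_mul_conj_den {g : Mat m} (h : IsSL2 g) (x : Hyp m) :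
    den (g 0 0) (g 0 1) x * conj (den (g 1 0) (g 1 1) x) =
      incl m (‖x.1‖ ^ 2 • (g 0 0 * conj (g 1 0)) + g 0 1 * conj (vec (proj x)) * conj (g 1 0) +
        (g 0 0 * vec (proj x) + g 0 1) * conj (g 1 1)) + height x • lastGen m := by
  have hx : vec x.1 = incl m (vec (proj x)) + height x • lastGen m := vec_eq_extend_add x.1
  set v := vec (proj x)
  set e := lastGen m with he
  set t := height x
  have hcx : conj (vec x.1) = incl m (conj v) - t • e := by
    rw [hx, conj_add, incl_conj, conj_smul, he, lastGen, conj_gen, smul_neg, sub_eq_add_neg]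
  have hn := vec_mul_conj x.1
  have hcomm : ∀ y : Cl m, e * incl m (conj y) = incl m (rev y) * e := by
    intro y
    rw [he, lastGen_mul_incl]
    simp [conj, rev, reverse_involute]
  have hdet : incl m (g 0 0) * incl m (rev (g 1 1)) -
      incl m (g 0 1) * incl m (rev (g 1 0)) = 1 := by
    rw [← map_mul, ← map_mul, ← map_sub, h.pseudoDet, map_one]
  have h1 : den (g 0 0) (g 0 1) x * conj (den (g 1 0) (g 1 1) x) =
      incl m (g 0 0) * (vec x.1 * conj (vec x.1)) * incl m (conj (g 1 0)) +
      incl m (g 0 1) * incl m (conj (g 1 1)) + incl m (g 0 0) * vec x.1 * incl m (conj (g 1 1)) +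
      incl m (g 0 1) * conj (vec x.1) * incl m (conj (g 1 0)) := by
    rw [den, den, conj_add, conj_mul, incl_conj, incl_conj]
    noncomm_ring
  have h2 : incl m (g 0 0) * e * incl m (conj (g 1 1)) -
      incl m (g 0 1) * e * incl m (conj (g 1 0)) = e := by
    rw [mul_assoc, mul_assoc, hcomm, hcomm, ← mul_assoc, ← mul_assoc, ← sub_mul, hdet, one_mul]
  rw [h1, hn, hcx, hx, Algebra.algebraMap_eq_smul_one]
  conv_rhs => rw [← h2]
  simp only [map_add, map_mul, map_smul, mul_add, add_mul, mul_sub, sub_mul, mul_smul_comm,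
    smul_mul_assoc, mul_one, smul_sub]
  abel

/-- The equation `|c x + d|² g(x) = (a x + b) \overline{(c x + d)}`, expanded. -/
theorem nsq_smul_vec_of_moebius {g : Mat m} (h : IsSL2 g) {x : Hyp m} {y : V (m + 1)}
    (hy : vec y = moebius (g.map (incl m)) (vec x.1)) :
    vec (nsq (den (g 1 0) (g 1 1) x) • y) =
      incl m (‖x.1‖ ^ 2 • (g 0 0 * conj (g 1 0)) + g 0 1 * conj (vec (proj x)) * conj (g 1 0) +
        (g 0 0 * vec (proj x) + g 0 1) * conj (g 1 1)) + height x • lastGen m := by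
  have hq := (h.isRow 1).den_mem x
  rw [← h.num_mul_conj_den x, vec_smul, Algebra.smul_def, Algebra.commutes, ← mul_conj hq,
    ← mul_assoc, hy, moebius]
  congr 1
  change _ * Ring.inverse (den _ _ _) * _ = _
  rw [mul_assoc, inverse_mul_cancel hq (h.den_ne_zero x), mul_one]
  rfl

/-- The height of `g x` is the height of `x` divided by `|c x + d|²`. -/
theorem nsq_mul_last_of_moebius {g : Mat m} (h : IsSL2 g) {x : Hyp m} {y : V (m + 1)}
    (hy : vec y = moebius (g.map (incl m)) (vec x.1)) :
    nsq (den (g 1 0) (g 1 1) x) * y (Fin.last (m + 1)) = height x :=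
  (last_and_proj_eq (nsq_smul_vec_of_moebius h hy)).1

theorem IsSL2.nsq_den_pos {g : Mat m} (h : IsSL2 g) (x : Hyp m) :
    0 < nsq (den (g 1 0) (g 1 1) x) := nsq_pos ((h.isRow 1).den_mem x) (h.den_ne_zero x)

theorem IsSL2.exists_mapsH {g : Mat m} (h : IsSL2 g) (x : Hyp m) : ∃ y, MapsH g x y := by
  obtain ⟨y, hy⟩ := mem_Vec.mp (h.map_incl.moebius_mem_Vec (vec_mem x.1) (h.den_ne_zero x))
  have h1 := nsq_mul_last_of_moebius h hy.symm
  have hx : 0 < height x := x.2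
  rw [← h1] at hx
  exact ⟨⟨y, pos_of_mul_pos_right hx (nsq_nonneg _)⟩, hy.symm⟩

theorem mapsH_unique {g : Mat m} {x y z : Hyp m} (hy : MapsH g x y) (hz : MapsH g x z) : y = z :=
  Subtype.ext (vec_injective (hy.trans hz.symm))

theorem MapsH.nsq_mul_height {g : Mat m} {x y : Hyp m} (hy : MapsH g x y) (h : IsSL2 g) :
    nsq (den (g 1 0) (g 1 1) x) * height y = height x := nsq_mul_last_of_moebius h hy

theorem MapsH.vec_mul_den {g : Mat m} {x y : Hyp m} (hy : MapsH g x y) (h : IsSL2 g) :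
    vec y.1 * den (g 1 0) (g 1 1) x = den (g 0 0) (g 0 1) x := by
  rw [hy, moebius]
  change _ * Ring.inverse (den _ _ _) * _ = _
  rw [mul_assoc, inverse_mul_cancel ((h.isRow 1).den_mem x) (h.den_ne_zero x), mul_one]
  rfl

theorem MapsH.den_mul {g h : Mat m} {x y : Hyp m} (hy : MapsH h x y) (hh : IsSL2 h) (i : Fin 2) :
    den ((g * h) i 0) ((g * h) i 1) x = den (g i 0) (g i 1) y * den (h 1 0) (h 1 1) x := by
  have h1 := row_mul_moebius (g := g.map (incl m)) (h := h.map (incl m)) (x := vec x.1)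
    ((hh.isRow 1).den_mem x) (hh.den_ne_zero x) i
  rw [← inclMap_mul, ← hy] at h1
  exact h1

theorem MapsH.mul {g h : Mat m} {x y z : Hyp m} (hz : MapsH g y z) (hy : MapsH h x y)
    (hg : IsSL2 g) (hh : IsSL2 h) : MapsH (g * h) x z := by
  rw [MapsH, inclMap_mul, moebius_mul ((hh.isRow 1).den_mem x) (hh.den_ne_zero x), ← hy, hz]
  · rw [← hy]; exact (hg.isRow 1).den_mem y
  · rw [← hy]; exact hg.den_ne_zero y

theorem mapsH_one (x : Hyp m) : MapsH 1 x x := by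
  simp [MapsH, moebius]

theorem MapsH.symm {g : Mat m} {x y : Hyp m} (hy : MapsH g x y) (h : IsSL2 g) :
    MapsH (ginv g) y x := by
  obtain ⟨z, hz⟩ := h.inv.exists_mapsH y
  have h1 := hz.mul hy h.inv h
  rw [h.ginv_mul] at h1
  rwa [mapsH_unique (mapsH_one x) h1]

/-- Elements of the stabilizer of `∞` act compatibly with the projection to the boundary. -/
theorem MapsH.proj {g : Mat m} {x y : Hyp m} (hy : MapsH g x y) (h : IsSL2 g) (hc : g 1 0 = 0) :
    MapsV g (proj x) (proj y) := by
  have hd : g 1 1 ≠ 0 := h.bottom_ne_zero.resolve_left (not_not.mpr hc)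
  obtain ⟨w, hw⟩ := mem_Vec.mp (h.moebius_mem_Vec (vec_mem (CliffordBianchi.proj x))
    (by rwa [hc, zero_mul, zero_add]))
  have h1 := (last_and_proj_eq (nsq_smul_vec_of_moebius h hy)).2
  have h2 : g 0 0 * vec (CliffordBianchi.proj x) + g 0 1 = vec w * g 1 1 := by
    rw [← hw, moebius, hc, zero_mul, zero_add, mul_assoc,
      inverse_mul_cancel (h.entries 1 1) hd, mul_one]
  have h3 : nsq (den (g 1 0) (g 1 1) x) = nsq (g 1 1) := by
    rw [den, hc, map_zero, zero_mul, zero_add, nsq_incl (h.entries 1 1)]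
  have h4 : vec (extend (nsq (g 1 1) • CliffordBianchi.proj y)) =
      vec (extend (nsq (g 1 1) • w)) := by
    rw [← incl_vec, ← incl_vec]
    have hzero : conj (0 : Cl m) = 0 := by simp [conj]
    rw [h3, h2, hc, hzero, mul_zero, mul_zero, smul_zero, add_zero, zero_add, mul_assoc,
      mul_conj (h.entries 1 1), ← Algebra.commutes, ← Algebra.smul_def, ← vec_smul] at h1
    exact h1
  have h5 := vec_injective h4
  have h6 : nsq (g 1 1) • CliffordBianchi.proj y = nsq (g 1 1) • w := by
    ext j
    rw [← extend_castSucc (nsq (g 1 1) • CliffordBianchi.proj y), h5, extend_castSucc]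
  rw [MapsV, hw, smul_right_injective _ (nsq_pos (h.entries 1 1) hd).ne' h6]

theorem mapsV_injective {g : Mat m} (h : IsSL2 g) (hc : g 1 0 = 0) {v w y : V m}
    (hv : MapsV g v y) (hw : MapsV g w y) : v = w := by
  have hd : g 1 1 ≠ 0 := h.bottom_ne_zero.resolve_left (not_not.mpr hc)
  have ha : g 0 0 ≠ 0 := by
    intro ha
    have := h.pseudoDet
    rw [ha, hc, rev_zero, zero_mul, mul_zero, sub_zero] at this
    exact zero_ne_one this
  obtain ⟨u, -, hu⟩ := exists_unit_of_ne_zero (h.entries 1 1) hd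
  obtain ⟨s, -, hs⟩ := exists_unit_of_ne_zero (h.entries 0 0) ha
  have h1 := hv.symm.trans hw
  rw [moebius, moebius, hc, zero_mul, zero_mul, zero_add, ← hu, Ring.inverse_unit, ← hs,
    Units.mul_left_inj, add_left_inj, Units.mul_right_inj] at h1
  exact vec_injective h1

/-! ### Finiteness, the bubble domain and discreteness of orbits -/

section order

variable {d : Fin m → ℚ} {O : Subring (Cl m)}

theorem Unimodular.isRow {c e : Cl m} (h : Unimodular O c e) : IsRow c e := by
  obtain ⟨g, hg, rfl, rfl⟩ := h
  exact hg.1.isRow 1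

theorem unimodular_zero_one : Unimodular O 0 (1 : Cl m) := ⟨1, one_mem_SL2, by simp, by simp⟩

/-- Only finitely many rows with entries in an order have bounded value `|c x + e|`: the height of
`x` bounds `c`, and then the triangle inequality bounds `e`. -/
theorem finite_rows (hd : ∀ j, 0 < d j) (hO : IsStarOrder d O) (x : Hyp m) (R : ℝ) :
    {p : Cl m × Cl m | p.1 ∈ O ∧ p.2 ∈ O ∧ IsRow p.1 p.2 ∧ nsq (den p.1 p.2 x) ≤ R}.Finite := by
  have hx : 0 < height x ^ 2 := pow_pos x.2 2
  refine ((finite_nsq_le hd hO (R / height x ^ 2)).prod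
    (finite_nsq_le hd hO (2 * R + 2 * (R / height x ^ 2 * ‖x.1‖ ^ 2)))).subset ?_
  rintro ⟨c, e⟩ ⟨hc, he, hrow, hR⟩
  dsimp only at hc he hrow hR
  have h1 : nsq c ≤ R / height x ^ 2 := by
    rw [le_div_iff₀ hx]
    exact (hrow.nsq_mul_height_le x).trans hR
  refine ⟨⟨hc, h1⟩, he, ?_⟩
  have h2 := nsq_sub_le (den c e x) (incl m c * vec x.1)
  rw [den, add_sub_cancel_left, nsq_mul _ (vec_mem_monoid (vec_mem _)), nsq_incl hrow.left,
    nsq_incl hrow.right, nsq_vec] at h2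
  rw [den] at hR
  have h3 := mul_le_mul_of_nonneg_right h1 (sq_nonneg ‖x.1‖)
  dsimp only
  linarith

theorem finite_unimodular (hd : ∀ j, 0 < d j) (hO : IsStarOrder d O) (x : Hyp m) (R : ℝ) :
    {p : Cl m × Cl m | Unimodular O p.1 p.2 ∧ nsq (den p.1 p.2 x) ≤ R}.Finite := by
  refine (finite_rows hd hO x R).subset ?_
  rintro ⟨c, e⟩ ⟨h, hR⟩
  refine ⟨?_, ?_, h.isRow, hR⟩ <;> obtain ⟨g, hg, rfl, rfl⟩ := h <;> exact hg.2 _ _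

/-- The bubble domain consists of the points with `|c x + e| > 1` for all unimodular pairs with
`c ≠ 0`. -/
theorem mem_bubbleDomain_iff {x : Hyp m} :
    x ∈ bubbleDomain O ↔ ∀ c e, Unimodular O c e → c ≠ 0 → 1 < nsq (den c e x) := by
  have key : ∀ l u : Cl m, Unimodular O l u → u ≠ 0 →
      (1 / absv u < absv (vec x.1 - incl m (Ring.inverse u * l)) ↔ 1 < nsq (den u (-l) x)) := by
    intro l u h hu
    have hrow := h.swap.isRow
    obtain ⟨p, hp, hden⟩ := hrow.exists_center hu
    have hpos := nsq_pos hrow.left hu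
    rw [nsq_den_of_center hrow.left (hden x)]
    rw [mul_neg, neg_neg] at hp
    rw [← hp, incl_vec, ← vec_sub, absv_eq, absv_eq, nsq_vec, Real.sqrt_sq (norm_nonneg _),
      div_lt_iff₀ (Real.sqrt_pos.mpr hpos), ← one_lt_sq_iff₀ (by positivity), mul_pow,
      Real.sq_sqrt hpos.le, mul_comm]
  constructor
  · intro hx c e h hc
    have h3 := h.swap.swap.swap
    rw [neg_neg] at h3
    simpa using (key _ _ h3 hc).mp (hx _ _ h3 hc)
  · intro hx l u h hu
    exact (key l u h hu).mpr (hx _ _ h.swap hu)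

theorem isOpen_bubbleDomain (hd : ∀ j, 0 < d j) (hO : IsStarOrder d O) :
    IsOpen (bubbleDomain O) := by
  rw [isOpen_iff_mem_nhds]
  intro x hx
  rw [mem_bubbleDomain_iff] at hx
  have hcont : ∀ p : Cl m × Cl m, IsRow p.1 p.2 → p.1 ≠ 0 →
      Continuous fun y : Hyp m => nsq (den p.1 p.2 y) := by
    intro p h hp
    obtain ⟨q, -, hq⟩ := h.exists_center hp
    simp only [fun y => nsq_den_of_center h.left (hq y)]
    fun_prop
  have hfin : ∀ᶠ y in 𝓝 x, ∀ p ∈ {p : Cl m × Cl m | Unimodular O p.1 p.2 ∧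
      nsq (den p.1 p.2 x) ≤ 4}, p.1 ≠ 0 → 1 < nsq (den p.1 p.2 y) := by
    rw [Filter.eventually_all_finite (finite_unimodular hd hO x 4)]
    rintro p ⟨hp, -⟩
    by_cases hp0 : p.1 = 0
    · exact Filter.Eventually.of_forall fun _ h => absurd hp0 h
    · filter_upwards [(hcont p hp.isRow hp0).continuousAt.eventually_const_lt
        (hx _ _ hp hp0)] with y hy _ using hy
  have hball : ∀ᶠ y : Hyp m in 𝓝 x, ‖y.1 - x.1‖ < height x / 2 := by
    have : Continuous fun y : Hyp m => ‖y.1 - x.1‖ := by fun_prop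
    refine this.continuousAt.eventually_lt_const ?_
    have := x.2
    simpa using this
  filter_upwards [hfin, hball] with y hy hyx
  rw [mem_bubbleDomain_iff]
  intro c e hce hc
  by_cases hle : nsq (den c e x) ≤ 4
  · exact hy (c, e) ⟨hce, hle⟩ hc
  · -- here `|y - p| ≥ |x - p| - |y - x| > |x - p| / 2`, since `|x - p|` is at least the height
    push Not at hle
    obtain ⟨p, -, hp⟩ := hce.isRow.exists_center hc
    have hcen := hce.isRow.left
    rw [nsq_den_of_center hcen (hp x)] at hle
    rw [nsq_den_of_center hcen (hp y)]
    have h1 : height x ≤ ‖x.1 - extend p‖ := by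
      refine le_of_sq_le_sq ?_ (norm_nonneg _)
      rw [norm_sq_sub_extend]
      linarith [sq_nonneg ‖proj x - p‖]
    have h2 : ‖x.1 - extend p‖ ≤ ‖y.1 - x.1‖ + ‖y.1 - extend p‖ := by
      rw [norm_sub_rev y.1 x.1]
      exact norm_sub_le_norm_sub_add_norm_sub x.1 y.1 (extend p)
    have h3 : ‖x.1 - extend p‖ / 2 ≤ ‖y.1 - extend p‖ := by linarith
    have h4 : (‖x.1 - extend p‖ / 2) ^ 2 ≤ ‖y.1 - extend p‖ ^ 2 :=
      pow_le_pow_left₀ (by positivity) h3 2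
    have h5 := mul_le_mul_of_nonneg_left h4 (nsq_nonneg c)
    linarith

theorem continuous_proj : Continuous (proj : Hyp m → V m) := by
  unfold proj
  fun_prop

/-- The point of hyperbolic space above `v` with height `t`. -/
def above (t : ℝ) (ht : 0 < t) (v : V m) : Hyp m :=
  ⟨WithLp.toLp 2 (Fin.snoc (fun j => v j) t), by simpa using ht⟩

theorem height_above {t : ℝ} (ht : 0 < t) (v : V m) : height (above t ht v) = t := by
  simp [height, above]

theorem proj_above {t : ℝ} (ht : 0 < t) (v : V m) : proj (above t ht v) = v := by
  ext j
  simp [above, proj]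

theorem continuous_above : Continuous fun p : Set.Ioi (0 : ℝ) × V m => above p.1.1 p.1.2 p.2 := by
  refine Continuous.subtype_mk ?_ _
  refine (PiLp.continuous_toLp 2 _).comp (continuous_pi fun j => ?_)
  refine Fin.lastCases ?_ (fun i => ?_) j
  · simp only [Fin.snoc_last]; fun_prop
  · simp only [Fin.snoc_castSucc]; fun_prop

theorem above_proj (x : Hyp m) : above (height x) x.2 (proj x) = x := by
  ext j
  refine Fin.lastCases ?_ (fun i => ?_) j
  · simp [above]
  · simp [above, proj]

/-- A point in the closed bubble domain above the closure of `F` is a limit of points of the open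
bubble domain above `F`: it suffices to increase its height, since this moves it strictly outside
all spheres. -/
theorem mem_closure_of_one_le (hd : ∀ j, 0 < d j) (hO : IsStarOrder d O) {F : Set (V m)}
    {z : Hyp m} (hz : ∀ c e, Unimodular O c e → 1 ≤ nsq (den c e z)) (hF : proj z ∈ closure F) :
    z ∈ closure {x | x ∈ bubbleDomain O ∧ proj x ∈ F} := by
  have hup : ∀ (t : ℝ) (ht : 0 < t), height z < t →
      above t ht (proj z) ∈ closure {x | x ∈ bubbleDomain O ∧ proj x ∈ F} := by
    intro t ht hzt
    refine (isOpen_bubbleDomain hd hO).inter_closure ⟨?_, ?_⟩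
    · rw [mem_bubbleDomain_iff]
      intro c e hce hc
      obtain ⟨p, -, hp⟩ := hce.isRow.exists_center hc
      have h1 := hz c e hce
      have hcen := hce.isRow.left
      rw [nsq_den_of_center hcen (hp z), norm_sq_sub_extend] at h1
      rw [nsq_den_of_center hcen (hp _), norm_sq_sub_extend, proj_above, height_above]
      have h2 : height z ^ 2 < t ^ 2 := pow_lt_pow_left₀ hzt z.2.le two_ne_zero
      have h3 := mul_lt_mul_of_pos_left h2 (nsq_pos hcen hc)
      linarith
    · refine map_mem_closure (t := {x : Hyp m | proj x ∈ F}) (f := above t ht) ?_ hF ?_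
      · exact continuous_above.comp (Continuous.prodMk_right (⟨t, ht⟩ : Set.Ioi (0 : ℝ)))
      · intro v hv
        simpa [proj_above] using hv
  rw [← closure_closure]
  have hlim : Filter.Tendsto (fun n : ℕ => above (height z + 1 / ((n : ℝ) + 1))
      (add_pos z.2 (by positivity)) (proj z)) Filter.atTop (𝓝 z) := by
    have h1 : Filter.Tendsto (fun n : ℕ => ((⟨height z + 1 / ((n : ℝ) + 1),
        add_pos z.2 (by positivity)⟩ : Set.Ioi (0 : ℝ)), proj z)) Filter.atTop
        (𝓝 ((⟨height z, z.2⟩ : Set.Ioi (0 : ℝ)), proj z)) := by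
      refine Filter.Tendsto.prodMk_nhds ?_ tendsto_const_nhds
      rw [tendsto_subtype_rng]
      simpa using (tendsto_one_div_add_atTop_nhds_zero_nat (𝕜 := ℝ)).const_add (height z)
    have h2 := (continuous_above.tendsto _).comp h1
    rwa [above_proj] at h2
  refine mem_closure_of_tendsto hlim (Filter.Eventually.of_forall fun n => hup _ _ ?_)
  have : (0 : ℝ) < 1 / ((n : ℝ) + 1) := by positivity
  linarith

/-- Orbits are discrete: only finitely many matrices move `x` into a bounded region of positive
height, because both of their rows are then bounded. -/
theorem isDiscrete_orbit (hd : ∀ j, 0 < d j) (hO : IsStarOrder d O) (x : Hyp m) :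
    IsDiscrete {y | ∃ g ∈ SL2 O, MapsH g x y} := by
  rw [isDiscrete_iff_forall_mem_exists_isOpen]
  intro y hy
  set A := {y | ∃ g ∈ SL2 O, MapsH g x y} with hA
  set U := {z : Hyp m | height y / 2 < height z ∧ ‖z.1‖ < ‖y.1‖ + 1} with hU
  have hUopen : IsOpen U := by
    have h1 : Continuous fun z : Hyp m => height z := by fun_prop
    have h2 : Continuous fun z : Hyp m => ‖z.1‖ := by fun_prop
    exact (isOpen_lt continuous_const h1).inter (isOpen_lt h2 continuous_const)
  have hypos : 0 < height y := y.2
  have hyU : y ∈ U := ⟨by linarith, by linarith⟩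
  have hfin : (U ∩ A).Finite := by
    set R := height x / (height y / 2) with hR
    refine (Set.Finite.biUnion ((finite_rows hd hO x ((‖y.1‖ + 1) ^ 2 * R)).prod
      (finite_rows hd hO x R)) (t := fun p => {z | MapsH !![p.1.1, p.1.2; p.2.1, p.2.2] x z})
      fun p _ => Set.Subsingleton.finite fun a ha b hb => mapsH_unique ha hb).subset ?_
    rintro z ⟨⟨hz1, hz2⟩, g, hg, hgz⟩
    have h1 : nsq (den (g 1 0) (g 1 1) x) ≤ R := by
      rw [hR, le_div_iff₀ (by positivity), ← hgz.nsq_mul_height hg.1]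
      exact mul_le_mul_of_nonneg_left hz1.le (nsq_nonneg _)
    have h2 : nsq (den (g 0 0) (g 0 1) x) ≤ (‖y.1‖ + 1) ^ 2 * R := by
      rw [← hgz.vec_mul_den hg.1, nsq_mul _ ((hg.1.isRow 1).den_mem x), nsq_vec]
      exact mul_le_mul (pow_le_pow_left₀ (norm_nonneg _) hz2.le 2) h1 (nsq_nonneg _)
        (by positivity)
    simp only [Set.mem_iUnion]
    refine ⟨((g 0 0, g 0 1), (g 1 0, g 1 1)), ⟨⟨hg.2 _ _, hg.2 _ _, hg.1.isRow 0, h2⟩,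
      hg.2 _ _, hg.2 _ _, hg.1.isRow 1, h1⟩, ?_⟩
    rw [← Matrix.eta_fin_two g]
    exact hgz
  refine ⟨U \ ((U ∩ A) \ {y}), hUopen.sdiff (hfin.subset Set.sdiff_subset).isClosed, ?_⟩
  ext z
  simp only [Set.mem_inter_iff, Set.mem_sdiff, Set.mem_singleton_iff]
  constructor
  · rintro ⟨⟨hzU, hz⟩, hzA⟩
    by_contra hne
    exact hz ⟨⟨hzU, hzA⟩, hne⟩
  · rintro rfl
    exact ⟨⟨hyU, fun h => h.2 rfl⟩, hy⟩

/-- Every orbit contains a point of maximal height; it satisfies `|c y + e| ≥ 1` for all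
unimodular pairs. -/
theorem exists_mapsH_one_le (hd : ∀ j, 0 < d j) (hO : IsStarOrder d O) (x : Hyp m) :
    ∃ g ∈ SL2 O, ∃ y, MapsH g x y ∧ ∀ c e, Unimodular O c e → 1 ≤ nsq (den c e y) := by
  obtain ⟨⟨c, e⟩, ⟨hce, -⟩, hmin⟩ := Set.exists_min_image _
    (fun p : Cl m × Cl m => nsq (den p.1 p.2 x)) (finite_unimodular hd hO x 1)
    ⟨(0, 1), unimodular_zero_one, by simp [den, nsq_one]⟩
  have hmin' : ∀ c' e', Unimodular O c' e' → nsq (den c e x) ≤ nsq (den c' e' x) := by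
    intro c' e' h
    by_cases hle : nsq (den c' e' x) ≤ 1
    · exact hmin (c', e') ⟨h, hle⟩
    · have := hmin (0, 1) ⟨unimodular_zero_one, by simp [den, nsq_one]⟩
      have h1 : nsq (den (0 : Cl m) 1 x) = 1 := by simp [den, nsq_one]
      dsimp only at this
      linarith
  obtain ⟨g, hg, rfl, rfl⟩ := hce
  obtain ⟨y, hy⟩ := hg.1.exists_mapsH x
  refine ⟨g, hg, y, hy, ?_⟩
  rintro _ _ ⟨h, hh, rfl, rfl⟩
  have h1 := hmin' _ _ ⟨h * g, mul_mem_SL2 hh hg, rfl, rfl⟩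
  rw [hy.den_mul hg.1, nsq_mul _ ((hg.1.isRow 1).den_mem x)] at h1
  exact (le_mul_iff_one_le_left (hg.1.nsq_den_pos x)).mp h1

/-- The part of the open bubble domain above a fundamental domain of the stabilizer of `∞` is a
fundamental domain. -/
theorem isFundamentalDomain_bubble (hd : ∀ j, 0 < d j) (hO : IsStarOrder d O) {F : Set (V m)}
    (hF : IsFundamentalDomain (SL2Infty O) MapsV F) :
    IsFundamentalDomain (SL2 O) MapsH {x | x ∈ bubbleDomain O ∧ proj x ∈ F} := by
  refine ⟨fun x => ?_, ?_⟩
  · obtain ⟨g, hg, y, hy, hmin⟩ := exists_mapsH_one_le hd hO x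
    obtain ⟨h, ⟨hh, hc⟩, w, hw, hwy⟩ := hF.cover (proj y)
    have hk := ginv_mem_SL2 hO.rev_mem hh
    obtain ⟨z, hz⟩ := hk.1.exists_mapsH y
    have hzy : MapsH h z y := by simpa [ginv_ginv] using hz.symm hk.1
    have hwz : proj z = w := mapsV_injective hh.1 hc (hzy.proj hh.1 hc) hwy
    refine ⟨ginv g * h, mul_mem_SL2 (ginv_mem_SL2 hO.rev_mem hg) hh, z,
      mem_closure_of_one_le hd hO ?_ (hwz ▸ hw), (hy.symm hg.1).mul hzy hg.1.inv hh.1⟩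
    -- `h` has bottom row `(0, d)` and `a d* = 1`: maximality at `y` gives `|d| ≥ 1`, so `|a| ≤ 1`
    have hden : nsq (den (ginv h 1 0) (ginv h 1 1) y) ≤ 1 := by
      have h1 := hmin _ _ ⟨h, hh, rfl, rfl⟩
      have h2 := congrArg nsq hh.1.pseudoDet
      rw [hc, rev_zero, mul_zero, sub_zero, nsq_mul _ (rev_mem_monoid (hh.1.entries 1 1)),
        nsq_rev (hh.1.entries 1 1), nsq_one] at h2
      rw [den, hc, map_zero, zero_mul, zero_add, nsq_incl (hh.1.entries 1 1)] at h1
      have h3 : den (ginv h 1 0) (ginv h 1 1) y = incl m (rev (h 0 0)) := by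
        simp [den, ginv, hc, rev_zero]
      rw [h3, nsq_incl (rev_mem_monoid (hh.1.entries 0 0)), nsq_rev (hh.1.entries 0 0)]
      nlinarith [nsq_nonneg (h 0 0)]
    rintro _ _ ⟨k, hk', rfl, rfl⟩
    have h1 := hmin _ _ ⟨k * ginv h, mul_mem_SL2 hk' hk, rfl, rfl⟩
    rw [hz.den_mul hk.1, nsq_mul _ ((hk.1.isRow 1).den_mem y)] at h1
    nlinarith [nsq_nonneg (den (k 1 0) (k 1 1) z)]
  · rintro g hg x ⟨hxB, hxF⟩ y ⟨hyB, hyF⟩ hxy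
    by_cases hc : g 1 0 = 0
    · exact hF.free g ⟨hg, hc⟩ _ hxF _ hyF (hxy.proj hg.1 hc)
    · -- both `g` and its inverse would strictly decrease heights
      exfalso
      rw [mem_bubbleDomain_iff] at hxB hyB
      have hk := ginv_mem_SL2 hO.rev_mem hg
      have hc' : ginv g 1 0 ≠ 0 := by
        intro h0
        have h1 : -rev (g 1 0) = 0 := h0
        rw [neg_eq_zero] at h1
        exact hc (by rw [← rev_rev (g 1 0), h1, rev_zero])
      have h1 := hxB _ _ ⟨g, hg, rfl, rfl⟩ hc
      have h2 := hyB _ _ ⟨ginv g, hk, rfl, rfl⟩ hc'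
      have h3 := hxy.nsq_mul_height hg.1
      have h4 := (hxy.symm hg.1).nsq_mul_height hk.1
      have h5 := mul_lt_mul_of_pos_right h1 y.2
      have h6 := mul_lt_mul_of_pos_right h2 x.2
      linarith

end order

end CliffordBianchi

end

theorem theoremT {m : ℕ} (d : Fin m → ℚ) (hd : ∀ j, 0 < d j)
    (O : Subring (CliffordBianchi.Cl m)) (hO : CliffordBianchi.IsStarOrder d O)
    (F : Set (CliffordBianchi.V m))
    (hF : CliffordBianchi.IsFundamentalDomain
      (CliffordBianchi.SL2Infty O) CliffordBianchi.MapsV F)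
    (D : Set (CliffordBianchi.Hyp m))
    (hD : D = {x | x ∈ CliffordBianchi.bubbleDomain O ∧ CliffordBianchi.proj x ∈ F}) :
    (∀ x : CliffordBianchi.Hyp m,
      IsDiscrete {y | ∃ g ∈ CliffordBianchi.SL2 O, CliffordBianchi.MapsH g x y}) ∧
    CliffordBianchi.IsFundamentalDomain (CliffordBianchi.SL2 O) CliffordBianchi.MapsH D ∧
    (IsOpen F → IsOpen D) := by
  subst hD
  exact ⟨CliffordBianchi.isDiscrete_orbit hd hO,
    CliffordBianchi.isFundamentalDomain_bubble hd hO hF,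
    fun hFo => (CliffordBianchi.isOpen_bubbleDomain hd hO).inter
      (hFo.preimage CliffordBianchi.continuous_proj)⟩
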